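/- **Setting.** Let $k$ be a separably closed field and $X$ a variety over $k$ (a geometrically integral separated scheme of finite type) with $k[X]^\times=k^\times$. A Cartier divisor $D=\{(U_i,f_i)\}$ has the associated sheaf $\mathcal O_X(D)\subseteq k(X)$ obtained by gluing $f_i^{-1}\mathcal O_{U_i}$; for $f\in k(X)^\times$ put $\operatorname{div}_D(f)=\{(U_i,ff_i)\}$. Since $X$ is integral, $\operatorname{Pic}(X)$ is the group of Cartier divisors modulo principal ones, and $[D]$ denotes the class of $D$; a class is effective if it contains an effective divisor. Let $M$ be a finitely generated abelian group whose torsion subgroup has order not divisible by the characteristic of $k$, let $\lambda:M\to\operatorname{Pic}(X)$ be a homomorphism, and let $M_{\mathrm{eff}}\subseteq M$ be the subgroup generated by all $m$ with $\lambda(m)$ effective. A *structure of Cox ring of $X$ of type $\lambda$* on an $M$-graded commutative $k$-algebra $R=\bigoplus_{m\in M}R_m$ is a map $\operatorname{div}:\bigcup_{m}(R_m\smallsetminus\{0\})\to\operatorname{CaDiv}(X)$ such that (i) whenever $[D]=\lambda(m)$, there is a $k$-linear isomorphism $\psi:R_m\to H^0(X,\mathcal O_X(D))$ with $\operatorname{div}(s)=\operatorname{div}_D(\psi(s))$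 for all nonzero $s\in R_m$; and (ii) for nonzero homogeneous $s,t$, the product $st$ is nonzero and $\operatorname{div}(st)=\operatorname{div}(s)+\operatorname{div}(t)$. A Cox ring is an algebra with such a structure, and isomorphisms of Cox rings are isomorphisms of graded $k$-algebras compatible with $\operatorname{div}$. **Presentation data.** Let $m_1,\dots,m_N\in M$ be generators of $M_{\mathrm{eff}}$, let $\Lambda=\mathbb Z^N$ with $\varphi:\Lambda\to M$, $\varphi(a)=\sum a_im_i$, and $\Lambda_0=\ker\varphi$. For each $i$ let $D_i$ be an effective Cartier divisor with $[D_i]=\lambda(m_i)$, and put $D_L=\sum a_iD_i$ for $L=(a_1,\dots,a_N)\in\Lambda$. Let $\chi:\Lambda_0\to k(X)^\times$ be a homomorphism with $\operatorname{div}_0(\chi(E))=D_E$ for all $E\in\Lambda_0$. Grade $k[T_1,\dots,T_N]$ by $M$ via $\deg T_i=m_i$, and for $L\in\Lambda$ let $\phi_L:k[T_1,\dots,T_N]_{\varphi(L)}\to H^0(X,\mathcal O_X(D_L))$ be the linear map sending each monomial $T^a$ of degree $\varphi(L)$ to $\chi(a-L)$. Let $g_1,\dots,g_s$ be homogeneous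 polynomials such that $\phi_{L}(g_i)=0$ whenever $g_i$ has degree $\varphi(L)$, $L\in\Lambda$. Let $R=k[T_1,\dots,T_N]/(g_1,\dots,g_s)$ with the induced $M$-grading, and let $\bar\phi_L:R_{\varphi(L)}\to H^0(X,\mathcal O_X(D_L))$ be the induced linear maps. **Proposition.** 1. For all such data the following are equivalent: (a) the maps $\bar\phi_L$ define a structure of Cox ring of type $\lambda$ on the graded algebra $R$, that is, there is such a structure with $\operatorname{div}(r)=\operatorname{div}_{D_L}(\bar\phi_L(r))$ for all $L\in\Lambda$ and all nonzero $r\in R_{\varphi(L)}$ (in particular $\bar\phi_L(r)\ne0$); (b) the graded algebra $R$ has a structure of Cox ring of type $\lambda$ in which the class of $T_i$ is nonzero with $\operatorname{div}(T_i)=D_i$ for all $i$; (c) $\bar\phi_L$ is an isomorphism for all $L\in\Lambda$. 2. Conversely, for every Cox ring $R'$ of $X$ of type $\lambda$ that is finitely generated as a $k$-algebra, there are data $N$, $(m_i)$, $(D_i)$, $\chi$, $(g_i)$ as above such that $R=k[T_1,\dots,T_N]/(g_1,\dots,g_s)$ has a Cox ring structure as in (a) and $R'\cong R$ as Cox rings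 of type $\lambda$. -/

import Mathlib

open CategoryTheory AlgebraicGeometry

universe u v w

noncomputable section

namespace CoxRing

/-! ### Cartier divisors on an integral scheme -/

section Cartier

variable (X : Scheme.{u}) [IsIntegral X]

/-- The image of `𝒪_{X,x}ˣ` in `k(X)ˣ`. -/
def stalkUnits (x : X) : Subgroup (X.functionField)ˣ :=
  (Units.map (algebraMap (X.presheaf.stalk x) X.functionField).toMonoidHom).range

/-- The stalk at `x` of the sheaf `𝒦ˣ / 𝒪ˣ`, written additively. -/
abbrev DivGerm (x : X) : Type u := Additive ((X.functionField)ˣ ⧸ stalkUnits X x)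

variable {X} in
/-- The germ at `x` of the divisor of the rational function `f`. -/
def germ (x : X) (f : (X.functionField)ˣ) : DivGerm X x :=
  Additive.ofMul (QuotientGroup.mk f)

variable {X} in
lemma germ_mul (x : X) (f g : (X.functionField)ˣ) : germ x (f * g) = germ x f + germ x g := rfl

variable {X} in
lemma germ_inv (x : X) (f : (X.functionField)ˣ) : germ x f⁻¹ = - germ x f := rfl

/-- The Cartier divisors, as a group of families of germs: global sections of `𝒦ˣ / 𝒪ˣ`, where `𝒦` is the constant sheaf
`k(X)`. A section is given by its germs, and a family of germs is a section exactly when it is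
locally the divisor of one rational function (that is, it is of the form `{(U_i, f_i)}`). -/
def cartierSubgroup : AddSubgroup (∀ x : X, DivGerm X x) where
  carrier := {D | ∀ x : X, ∃ U : X.Opens, x ∈ U ∧ ∃ f : (X.functionField)ˣ,
    ∀ y ∈ U, D y = germ y f}
  zero_mem' := fun _ => ⟨⊤, trivial, 1, fun _ _ => rfl⟩
  add_mem' := by
    intro D E hD hE x
    obtain ⟨U, hU, f, hf⟩ := hD x
    obtain ⟨V, hV, g, hg⟩ := hE x
    refine ⟨U ⊓ V, ⟨hU, hV⟩, f * g, fun y hy => ?_⟩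
    rw [germ_mul, ← hf y hy.1, ← hg y hy.2]
    rfl
  neg_mem' := by
    intro D hD x
    obtain ⟨U, hU, f, hf⟩ := hD x
    refine ⟨U, hU, f⁻¹, fun y hy => ?_⟩
    rw [germ_inv, ← hf y hy]
    rfl

/-- The group of Cartier divisors. -/
def CaDiv : Type u := cartierSubgroup X

instance : AddCommGroup (CaDiv X) := inferInstanceAs (AddCommGroup (cartierSubgroup X))

/-- The principal Cartier divisor `{(X, f)}` of a nonzero rational function `f`. -/
def principal : Additive (X.functionField)ˣ →+ CaDiv X where
  toFun f := ⟨fun x => germ x f.toMul, fun _ => ⟨⊤, trivial, f.toMul, fun _ _ => rfl⟩⟩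
  map_zero' := rfl
  map_add' _ _ := rfl

/-- The Picard group of the integral scheme `X`, in the form of the group of Cartier divisors modulo
principal divisors. -/
def Pic : Type u := CaDiv X ⧸ (principal X).range

instance : AddCommGroup (Pic X) := inferInstanceAs (AddCommGroup (CaDiv X ⧸ (principal X).range))

variable {X}

/-- The class of a Cartier divisor. -/
def cls : CaDiv X →+ Pic X := QuotientAddGroup.mk' (principal X).range

/-- `div_D(f)`: if `D = {(U_i, f_i)}` then this is `{(U_i, f f_i)}`. -/
def divAt (D : CaDiv X) (f : (X.functionField)ˣ) : CaDiv X :=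
  principal X (Additive.ofMul f) + D

/-- `D = {(U_i, f_i)}` is effective if all the `f_i` are regular on `U_i`. -/
def IsEffective (D : CaDiv X) : Prop :=
  ∀ (x : X) (f : (X.functionField)ˣ), D.1 x = germ x f →
    (f : X.functionField) ∈ (algebraMap (X.presheaf.stalk x) X.functionField).range

/-- A class in the Picard group is effective if it contains an effective divisor. -/
def IsEffectiveClass (c : Pic X) : Prop := ∃ D : CaDiv X, IsEffective D ∧ cls D = c

end Cartier

/-! ### Global sections of `𝒪_X(D)` for `X` over a field `k` -/

section Sections

variable (k : Type u) [Field k] (X : Scheme.{u}) [X.Over (Spec (.of k))]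

/-- The structure map `k → H⁰(X, 𝒪_X)`. -/
def constants : k →+* Γ(X, ⊤) :=
  ((Scheme.ΓSpecIso (.of k)).inv ≫ (X ↘ Spec (.of k)).appTop).hom

variable [IsIntegral X]

/-- The function field of a `k`-scheme as a `k`-algebra. -/
instance functionFieldAlgebra : Algebra k X.functionField :=
  ((X.presheaf.germ ⊤ (genericPoint X) trivial).hom.comp (constants k X)).toAlgebra

variable {X}

lemma algebraMap_mem_range (c : k) (x : X) :
    algebraMap k X.functionField c ∈
      (algebraMap (X.presheaf.stalk x) X.functionField).range :=
  ⟨X.presheaf.germ ⊤ x trivial (constants k X c),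
    haveI : Nonempty (⊤ : X.Opens) := ⟨⟨x, trivial⟩⟩
    Scheme.algebraMap_germ_eq_germToFunctionField X (U := ⊤) trivial _⟩

/-- `H⁰(X, 𝒪_X(D)) ⊆ k(X)`: for `D = {(U_i, f_i)}`, the rational functions lying in
`f_i⁻¹ 𝒪_{X,x}` for all `i` and all `x ∈ U_i`. -/
def H0 (D : CaDiv X) : Submodule k X.functionField where
  carrier := {s | ∀ (x : X) (f : (X.functionField)ˣ), D.1 x = germ x f →
    (f : X.functionField) * s ∈ (algebraMap (X.presheaf.stalk x) X.functionField).range}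
  zero_mem' := by
    intro x f _
    rw [mul_zero]
    exact zero_mem _
  add_mem' := by
    intro s t hs ht x f hf
    rw [mul_add]
    exact add_mem (hs x f hf) (ht x f hf)
  smul_mem' := by
    intro c s hs x f hf
    rw [Algebra.smul_def, mul_left_comm]
    exact mul_mem (algebraMap_mem_range k c x) (hs x f hf)

end Sections

/-! ### Cox rings of type `lam : M → Pic X` -/

section CoxRings

variable (k : Type u) [Field k] {X : Scheme.{u}} [X.Over (Spec (.of k))] [IsIntegral X]
  {M : Type v} [AddCommGroup M]

/-- `M_eff`: the subgroup generated by the `m` such that `lam m` is an effective class. -/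
def Meff (lam : M →+ Pic X) : AddSubgroup M :=
  AddSubgroup.closure {m | IsEffectiveClass (lam m)}

variable {k}
variable {R : Type w} [CommRing R] [Algebra k R]

/-- The nonzero homogeneous elements: the union of the sets `R_m \ {0}`. -/
abbrev HomogNonzero (A : M → Submodule k R) : Type w := {s : R // s ≠ 0 ∧ ∃ m, s ∈ A m}

/-- A structure of Cox ring of `X` of type `lam` on the `k`-algebra `R` with the grading
`R = ⨁ A m`. -/
structure CoxStructure [DecidableEq M] (lam : M →+ Pic X) (A : M → Submodule k R) where
  gradedMonoid : SetLike.GradedMonoid A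
  isInternal : DirectSum.IsInternal A
  div : HomogNonzero A → CaDiv X
  exists_equiv : ∀ (m : M) (D : CaDiv X), cls D = lam m →
    ∃ ψ : A m ≃ₗ[k] H0 k D, ∀ (s : R) (hs : s ∈ A m) (h0 : s ≠ 0),
      ∃ f : (X.functionField)ˣ, (f : X.functionField) = ψ ⟨s, hs⟩ ∧
        div ⟨s, h0, m, hs⟩ = divAt D f
  div_mul : ∀ s t : HomogNonzero A, ∃ r : HomogNonzero A,
    r.1 = s.1 * t.1 ∧ div r = div s + div t

/-- `Q` (with `S'`) and `R` (with `S`) are isomorphic as Cox rings of type `lam`: there is an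
isomorphism of graded `k`-algebras that is compatible with the maps `div`. -/
def CoxStructure.Isomorphic [DecidableEq M] {lam : M →+ Pic X} {A : M → Submodule k R}
    (S : CoxStructure lam A) {Q : Type*} [CommRing Q] [Algebra k Q] {B : M → Submodule k Q}
    (S' : CoxStructure lam B) : Prop :=
  ∃ e : R ≃ₐ[k] Q, (∀ (m : M) (s : R), s ∈ A m ↔ e s ∈ B m) ∧
    ∀ (s : HomogNonzero A) (t : HomogNonzero B), e s.1 = t.1 → S'.div t = S.div s

end CoxRings

/-! ### Generators, characters and the maps `φ_L` -/

/-- The homomorphism `ℤ^N → A` that sends `(a_1, …, a_N)` to `∑ a_i v_i`. -/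
def comb {A : Type*} [AddCommGroup A] {N : ℕ} (v : Fin N → A) : (Fin N → ℤ) →+ A where
  toFun a := ∑ i, a i • v i
  map_zero' := by simp
  map_add' a b := by simp [add_smul, Finset.sum_add_distrib]

/-- An exponent vector as an element of the lattice `ℤ^N`. -/
def expo {N : ℕ} (a : Fin N →₀ ℕ) : Fin N → ℤ := fun i => (a i : ℤ)

lemma expo_add {N : ℕ} (a b : Fin N →₀ ℕ) : expo (a + b) = expo a + expo b := by
  ext i; simp [expo]

lemma comb_expo {A : Type*} [AddCommGroup A] {N : ℕ} (v : Fin N → A) (a : Fin N →₀ ℕ) :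
    comb v (expo a) = Finsupp.weight v a := by
  simp [comb, expo, Finsupp.weight_apply, Finsupp.sum_fintype]

section Data

variable {X : Scheme.{u}} [IsIntegral X] {M : Type v} [AddCommGroup M]

/-- Generators `m_i = deg i` of `M_eff`, effective Cartier divisors `D i` in the classes `lam (m_i)`,
and a character `χ : Λ_0 → k(X)ˣ` on the kernel `Λ_0` of `φ : Λ = ℤ^N → M` that satisfies
`div_0 (χ E) = D_E` for all `E ∈ Λ_0`. -/
structure GeneratorData (lam : M →+ Pic X) (N : ℕ) where
  deg : Fin N → M
  closure_deg : AddSubgroup.closure (Set.range deg) = Meff lam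
  D : Fin N → CaDiv X
  cls_D : ∀ i, cls (D i) = lam (deg i)
  effective_D : ∀ i, IsEffective (D i)
  χ : (comb deg).ker →+ Additive (X.functionField)ˣ
  div_χ : ∀ E : (comb deg).ker, divAt 0 (χ E).toMul = comb D E.1

end Data

namespace GeneratorData

variable {k : Type u} [Field k] {X : Scheme.{u}} [X.Over (Spec (.of k))] [IsIntegral X]
  {M : Type v} [AddCommGroup M] {lam : M →+ Pic X} {N : ℕ} (P : GeneratorData lam N)

/-- `φ : Λ → M`. -/
abbrev phi : (Fin N → ℤ) →+ M := comb P.deg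

/-- `D_L = ∑ a_i D_i` for `L = ∑ a_i m_i`. -/
abbrev DL (L : Fin N → ℤ) : CaDiv X := comb P.D L

open Classical in
/-- `χ(a - L)` if `φ(a) = φ(L)`, and `0` otherwise. -/
def monomialValue (L : Fin N → ℤ) (a : Fin N →₀ ℕ) : X.functionField :=
  if h : expo a - L ∈ P.phi.ker then ((P.χ ⟨expo a - L, h⟩).toMul : X.functionField) else 0

lemma monomialValue_mem (L : Fin N → ℤ) (a : Fin N →₀ ℕ) :
    P.monomialValue L a ∈ H0 k (P.DL L) := by
  unfold monomialValue
  split_ifs with h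
  · intro x f hf
    have heff : IsEffective (comb P.D (expo a)) := by
      have key : ∀ t : Finset (Fin N), IsEffective (∑ i ∈ t, expo a i • P.D i) := by
        intro t x
        induction t using Finset.induction_on with
        | empty =>
          intro f hf
          have h1 : f ∈ stalkUnits X x := by
            have : germ x (1 : (X.functionField)ˣ) = germ x f := by
              rw [← hf]; rfl
            simpa using QuotientGroup.eq.mp (Additive.ofMul.injective this)
          obtain ⟨u, rfl⟩ := h1
          exact ⟨u, rfl⟩
        | insert i t hi ih =>
          intro f hf
          obtain ⟨_, _, p, hp⟩ := (∑ i ∈ t, expo a i • P.D i).2 x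
          obtain ⟨_, _, q, hq⟩ := (P.D i).2 x
          have hp := hp x ‹_›
          have hq := hq x ‹_›
          have hmul : germ x (q ^ (a i) * p) = germ x f := by
            rw [← hf, Finset.sum_insert hi]
            change _ = (expo a i • P.D i).1 x + _
            rw [hp, germ_mul]
            congr 1
            change _ = expo a i • (P.D i).1 x
            rw [hq]
            simp only [expo, natCast_zsmul]
            rfl
          obtain ⟨u, hu⟩ := QuotientGroup.eq.mp (Additive.ofMul.injective hmul)
          have hfe : f = q ^ (a i) * p * (Units.map
              (algebraMap (X.presheaf.stalk x) X.functionField).toMonoidHom u) := by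
            rw [hu]; group
          rw [hfe]
          push_cast
          refine mul_mem (mul_mem (pow_mem (P.effective_D i x q hq) _) (ih p hp)) ⟨u, rfl⟩
      exact key Finset.univ
    have := heff x (f * (P.χ ⟨expo a - L, h⟩).toMul) ?_
    · simpa using this
    · have h2 := P.div_χ ⟨expo a - L, h⟩
      have h3 : comb P.D (expo a) = P.DL L + divAt 0 (P.χ ⟨expo a - L, h⟩).toMul := by
        rw [h2, ← map_add]; congr 1; simp
      rw [h3, germ_mul, ← hf, divAt, add_zero]
      rfl
  · exact zero_mem _

variable (k) in
/-- The linear map `φ_L`, sending a monomial `T^a` of degree `φ(L)` to `χ(a - L)`. It is extended by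
`0` to the monomials of other degrees. -/
def phiL (L : Fin N → ℤ) : MvPolynomial (Fin N) k →ₗ[k] H0 (X := X) k (P.DL L) :=
  (MvPolynomial.basisMonomials (Fin N) k).constr k
    fun a => ⟨P.monomialValue L a, P.monomialValue_mem L a⟩

variable {s : ℕ} (g : Fin s → MvPolynomial (Fin N) k)

/-- Each `g_i` is homogeneous, and `φ_L(g_i) = 0` if `L` is such that `g_i` has degree `φ(L)`. -/
def AreRelations : Prop :=
  ∀ i, (∃ m, MvPolynomial.IsWeightedHomogeneous P.deg (g i) m) ∧
    ∀ L, MvPolynomial.IsWeightedHomogeneous P.deg (g i) (P.phi L) → P.phiL k L (g i) = 0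

/-- `R = k[T_1, …, T_N] / (g_1, …, g_s)`. -/
abbrev Quot {N s : ℕ} (g : Fin s → MvPolynomial (Fin N) k) : Type u :=
  MvPolynomial (Fin N) k ⧸ Ideal.span (Set.range g)

/-- The degree `m` part of `R`, where `T_i` has degree `m_i`. -/
def quotGrading (m : M) : Submodule k (Quot g) :=
  (MvPolynomial.weightedHomogeneousSubmodule k P.deg m).map
    (Ideal.Quotient.mkₐ k (Ideal.span (Set.range g))).toLinearMap

lemma phiL_monomial_coe (L : Fin N → ℤ) (a : Fin N →₀ ℕ) (c : k) :
    (P.phiL k L (MvPolynomial.monomial a c) : X.functionField) = c • P.monomialValue L a := by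
  have h : MvPolynomial.monomial a c = c • MvPolynomial.basisMonomials (Fin N) k a := by
    simp [MvPolynomial.coe_basisMonomials, MvPolynomial.smul_monomial]
  rw [h, map_smul, phiL, Module.Basis.constr_basis]
  rfl

lemma monomialValue_of_mem {L : Fin N → ℤ} {a : Fin N →₀ ℕ} (h : expo a - L ∈ P.phi.ker) :
    P.monomialValue L a = ((P.χ ⟨expo a - L, h⟩).toMul : X.functionField) := by
  rw [monomialValue, dif_pos h]

lemma monomialValue_of_notMem {L : Fin N → ℤ} {a : Fin N →₀ ℕ} (h : expo a - L ∉ P.phi.ker) :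
    P.monomialValue L a = 0 := by
  rw [monomialValue, dif_neg h]

lemma phiL_apply_coe (L : Fin N → ℤ) (p : MvPolynomial (Fin N) k) :
    (P.phiL k L p : X.functionField) = ∑ a ∈ p.support, p.coeff a • P.monomialValue L a := by
  conv_lhs => rw [p.as_sum]
  rw [map_sum, AddSubmonoidClass.coe_finsetSum]
  exact Finset.sum_congr rfl fun a _ => P.phiL_monomial_coe L a _

lemma phiL_monomial_mul {L : Fin N → ℤ} {q : MvPolynomial (Fin N) k}
    (hq : ∃ m, MvPolynomial.IsWeightedHomogeneous P.deg q m)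
    (h0 : ∀ L, MvPolynomial.IsWeightedHomogeneous P.deg q (P.phi L) → P.phiL k L q = 0)
    (b : Fin N →₀ ℕ) (c : k) : P.phiL k L (MvPolynomial.monomial b c * q) = 0 := by
  obtain ⟨m, hm⟩ := hq
  apply Subtype.ext
  have e : (P.phiL k L (MvPolynomial.monomial b c * q) : X.functionField) =
      ∑ a ∈ q.support, (c * q.coeff a) • P.monomialValue L (b + a) := by
    conv_lhs => rw [q.as_sum, Finset.mul_sum]
    rw [map_sum, AddSubmonoidClass.coe_finsetSum]
    refine Finset.sum_congr rfl fun a _ => ?_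
    rw [MvPolynomial.monomial_mul, P.phiL_monomial_coe]
  rw [e]
  by_cases hL : m = P.phi (L - expo b)
  · subst hL
    have hz := h0 _ hm
    have hz' := congrArg Subtype.val hz
    rw [P.phiL_apply_coe] at hz'
    have hconst : ∀ a ∈ q.support, P.monomialValue L (b + a) =
        P.monomialValue (L - expo b) a := by
      intro a ha
      have h1 : expo (b + a) - L = expo a - (L - expo b) := by
        rw [expo_add]; abel
      by_cases h : expo a - (L - expo b) ∈ P.phi.ker
      · rw [P.monomialValue_of_mem h, P.monomialValue_of_mem (h1 ▸ h)]
        simp only [h1]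
      · rw [P.monomialValue_of_notMem h, P.monomialValue_of_notMem (h1 ▸ h)]
    calc _ = c • ∑ a ∈ q.support, q.coeff a • P.monomialValue (L - expo b) a := by
            rw [Finset.smul_sum]
            exact Finset.sum_congr rfl fun a ha => by rw [hconst a ha, mul_smul]
      _ = 0 := by rw [hz']; simp
  · refine Finset.sum_eq_zero fun a ha => ?_
    rw [P.monomialValue_of_notMem, smul_zero]
    intro hmem
    apply hL
    have h1 := hm (MvPolynomial.mem_support_iff.mp ha)
    rw [← h1, ← comb_expo]
    have h2 : P.phi (expo (b + a) - L) = 0 := hmem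
    rw [← sub_eq_zero, ← map_sub, ← h2, expo_add]
    congr 1
    abel

lemma span_le_ker (hg : P.AreRelations g) (L : Fin N → ℤ) :
    (Ideal.span (Set.range g)).restrictScalars k ≤ LinearMap.ker (P.phiL k L) := by
  intro p hp
  rw [LinearMap.mem_ker]
  have hp' : p ∈ Submodule.span (MvPolynomial (Fin N) k) (Set.range g) := hp
  obtain ⟨c, rfl⟩ := (Submodule.mem_span_range_iff_exists_fun _).mp hp'
  rw [map_sum]
  refine Finset.sum_eq_zero fun i _ => ?_
  rw [smul_eq_mul, (c i).as_sum, Finset.sum_mul, map_sum]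
  exact Finset.sum_eq_zero fun b _ => P.phiL_monomial_mul (hg i).1 (hg i).2 b _

/-- The linear map `R_{φ(L)} → H⁰(X, 𝒪_X(D_L))` induced by `φ_L`. -/
def inducedMap (hg : P.AreRelations g) (L : Fin N → ℤ) :
    P.quotGrading g (P.phi L) →ₗ[k] H0 (X := X) k (P.DL L) :=
  (Submodule.liftQ ((Ideal.span (Set.range g)).restrictScalars k) (P.phiL k L)
    (P.span_le_ker g hg L)).domRestrict (P.quotGrading g (P.phi L))

lemma inducedMap_mk (hg : P.AreRelations g) (L : Fin N → ℤ) (p : MvPolynomial (Fin N) k)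
    (hp : Ideal.Quotient.mk (Ideal.span (Set.range g)) p ∈ P.quotGrading g (P.phi L)) :
    P.inducedMap g hg L ⟨Ideal.Quotient.mk _ p, hp⟩ = P.phiL k L p := rfl

/-- The divisors of the Cox ring structure `S` on `R` are the ones given by the induced maps:
`div s = div_{D_L}(φ_L(s))` for all nonzero `s ∈ R_{φ(L)}`. -/
def IsInduced [DecidableEq M] (hg : P.AreRelations g) (S : CoxStructure lam (P.quotGrading g)) :
    Prop :=
  ∀ (L : Fin N → ℤ) (r : Quot g) (hr : r ∈ P.quotGrading g (P.phi L)) (h0 : r ≠ 0),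
    ∃ f : (X.functionField)ˣ, (f : X.functionField) = P.inducedMap g hg L ⟨r, hr⟩ ∧
      S.div ⟨r, h0, _, hr⟩ = divAt (P.DL L) f

/-- The class of each variable `T_i` in `R` is nonzero with divisor `D_i`. -/
def VariablesHaveDivisors [DecidableEq M] (S : CoxStructure lam (P.quotGrading g)) : Prop :=
  ∀ i, ∃ t : HomogNonzero (P.quotGrading g),
    t.1 = Ideal.Quotient.mk _ (MvPolynomial.X i) ∧ S.div t = P.D i

end GeneratorData

end CoxRing

end

/-!
The proof rests on one rigidity principle. As `k[X]ˣ = kˣ`, a rational function with trivial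
divisor is a constant (`UnitsAreConstant.exists_algebraMap_eq`). A linear map that multiplies
every vector by a scalar is itself a scalar, so two linear families of rational functions whose
divisors differ by a fixed divisor are proportional (`UnitsAreConstant.exists_eq_mul`).

Let nonzero homogeneous elements `f_i` of a Cox ring be given whose degrees generate `M_eff`. In
each degree the divisors are computed by some linear map to `k(X)`, and rigidity shows that the
quotient of the values of two monomials `f^a`, `f^b` of equal degree depends only on `a - b`. This
defines a character `χ` with `div_0 (χ E) = D_E` (`HomogeneousFamily.character`), and the maps
`φ_L` for this character compute the divisors of the Cox ring
(`HomogeneousFamily.phiL_generatorData`).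

If the induced maps are bijective, the divisors `div_{D_L}(φ_L(r))` do not depend on `L`, and they
are additive because the `φ_L` are multiplicative; degrees outside `M_eff` carry neither elements
of `R` nor sections. So they form a Cox ring structure. Conversely, an induced structure forces
`φ_L` to be injective, and by rigidity it agrees up to a constant on each vector with an
isomorphism onto the sections, so it is surjective. An induced structure gives `T_i` the divisor
`D_i` because `φ_L(T_i) = χ(0) = 1` for the unit vector `L`.

Suppose now that `R` has a structure in which `T_i` has divisor `D_i`. It is induced by its own
character, which differs from the given `χ` by a homomorphism `θ` with values in `kˣ`. Write `K_n`
for the ideal of polynomials killed by the maps `φ_L` of the character multiplied by `θ^n`.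
Twisting the coefficients of homogeneous polynomials by `θ` takes the inclusion `K_0 ⊆ K_1`, which
holds because `K_0` is generated by the `g_i` and these lie in `K_1`, to `K_n ⊆ K_{n+1}` for all
`n`. The chain becomes stationary, and twisting back gives `K_0 = K_1`
(`GeneratorData.kernelIdeal_twist_le_of_le`). Thus the induced maps for `χ` are injective; they
are surjective because twisting does not change the image.

For a finitely generated Cox ring, finitely many homogeneous generators and finitely many
homogeneous generators of the ideal of their relations give the presentation, with the character
above (`CoxStructure.exists_presentation`).
-/

namespace CoxRing

/-! ### Rational functions with trivial divisor -/

section Geometry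

variable {X : Scheme.{u}} [IsIntegral X]

/-- The local representatives agree on overlaps because every nonempty open set contains the generic
point, at whose stalk they all have the germ `f`. -/
theorem exists_globalSection_of_forall_mem_stalk (f : X.functionField)
    (h : ∀ x : X, f ∈ (algebraMap (X.presheaf.stalk x) X.functionField).range) :
    ∃ s : Γ(X, ⊤), X.presheaf.germ ⊤ (genericPoint X) trivial s = f := by
  have key : ∀ x : X, ∃ (U : X.Opens) (_ : x ∈ U) (t : Γ(X, U)) (hη : genericPoint X ∈ U),
      X.presheaf.germ U (genericPoint X) hη t = f := by
    intro x
    obtain ⟨y, hy⟩ := h x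
    obtain ⟨U, hxU, t, rfl⟩ := X.presheaf.exists_germ_eq y
    have : Nonempty U := ⟨⟨x, hxU⟩⟩
    refine ⟨U, hxU, t, ((genericPoint_spec X).mem_open_set_iff U.isOpen).mpr ⟨x, trivial, hxU⟩, ?_⟩
    rw [← hy, Scheme.algebraMap_germ_eq_germToFunctionField X hxU]
  choose U hU t hη ht using key
  have hcompat : TopCat.Presheaf.IsCompatible X.sheaf.1 U t := by
    intro x y
    apply germ_injective_of_isIntegral X (genericPoint X)
      (show genericPoint X ∈ U x ⊓ U y from ⟨hη x, hη y⟩)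
    erw [TopCat.Presheaf.germ_res_apply, TopCat.Presheaf.germ_res_apply]
    exact (ht x).trans (ht y).symm
  obtain ⟨s, hs, -⟩ := X.sheaf.existsUnique_gluing' U ⊤ (fun x => homOfLE le_top)
    (fun x _ => TopologicalSpace.Opens.mem_iSup.mpr ⟨x, hU x⟩) t hcompat
  refine ⟨s, ?_⟩
  rw [← ht (genericPoint X), ← hs (genericPoint X)]
  exact (TopCat.Presheaf.germ_res_apply X.presheaf (homOfLE le_top) _ (hη _) s).symm

lemma mem_stalkUnits_of_principal_eq_zero {f : (X.functionField)ˣ}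
    (hf : principal X (Additive.ofMul f) = 0) (x : X) : f ∈ stalkUnits X x := by
  have h : germ x f = germ x 1 := congrFun (congrArg Subtype.val hf) x
  simpa using QuotientGroup.eq.mp (Additive.ofMul.injective h).symm

variable {k : Type u} [Field k] [X.Over (Spec (.of k))]

variable (X k) in
/-- The hypothesis `k[X]ˣ = kˣ`. -/
def UnitsAreConstant : Prop := ∀ f : Γ(X, ⊤), IsUnit f → ∃ c : k, constants k X c = f

/-- A rational function with trivial divisor is a global unit, hence a constant. -/
theorem UnitsAreConstant.exists_algebraMap_eq (hX : UnitsAreConstant X k)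
    {f : (X.functionField)ˣ} (hf : principal X (Additive.ofMul f) = 0) :
    ∃ c : k, algebraMap k X.functionField c = f := by
  obtain ⟨s, hs⟩ := exists_globalSection_of_forall_mem_stalk (f : X.functionField) fun x => by
    obtain ⟨u, hu⟩ := mem_stalkUnits_of_principal_eq_zero hf x
    exact ⟨u, congrArg Units.val hu⟩
  obtain ⟨t, ht⟩ := exists_globalSection_of_forall_mem_stalk
    ((f⁻¹ : (X.functionField)ˣ) : X.functionField) fun x => by
      obtain ⟨u, hu⟩ := inv_mem (mem_stalkUnits_of_principal_eq_zero hf x)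
      exact ⟨u, congrArg Units.val hu⟩
  have hst : s * t = 1 := by
    apply germ_injective_of_isIntegral X (U := ⊤) (genericPoint X) trivial
    rw [map_mul, map_one, hs, ht, Units.mul_inv]
  obtain ⟨c, hc⟩ := hX s (IsUnit.of_mul_eq_one t hst)
  refine ⟨c, ?_⟩
  rw [← hs, ← hc]
  rfl

/-! ### Divisors and sections -/

lemma divAt_mul (D : CaDiv X) (f g : (X.functionField)ˣ) :
    divAt D (f * g) = divAt (divAt D f) g := by
  unfold divAt
  rw [ofMul_mul, map_add]
  abel

lemma divAt_one (D : CaDiv X) : divAt D 1 = D := by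
  unfold divAt
  rw [ofMul_one, map_zero, zero_add]

lemma divAt_add_divAt (D E : CaDiv X) (f g : (X.functionField)ˣ) :
    divAt D f + divAt E g = divAt (D + E) (f * g) := by
  unfold divAt
  rw [ofMul_mul, map_add]
  abel

lemma divAt_val (D : CaDiv X) (f : (X.functionField)ˣ) (x : X) :
    (divAt D f).1 x = germ x f + D.1 x := rfl

lemma cls_divAt (D : CaDiv X) (f : (X.functionField)ˣ) : cls (divAt D f) = cls D := by
  unfold divAt
  rw [map_add, add_eq_right]
  exact (QuotientAddGroup.eq_zero_iff _).mpr ⟨_, rfl⟩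

lemma exists_divAt_eq_of_cls_eq {D E : CaDiv X} (h : cls D = cls E) :
    ∃ f : (X.functionField)ˣ, E = divAt D f := by
  obtain ⟨f, hf⟩ := QuotientAddGroup.eq.mp h
  refine ⟨f.toMul, ?_⟩
  unfold divAt
  rw [ofMul_toMul, hf]
  abel

lemma cls_surjective : Function.Surjective (cls : CaDiv X →+ Pic X) :=
  QuotientAddGroup.mk'_surjective _

/-- The nonzero sections of `𝒪_X(D)` are the rational functions `s` with `div_D(s)` effective. -/
theorem isEffective_divAt_iff (D : CaDiv X) (s : (X.functionField)ˣ) :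
    IsEffective (divAt D s) ↔ (s : X.functionField) ∈ H0 k D := by
  constructor
  · intro h x f hf
    rw [mul_comm, ← Units.val_mul]
    apply h x
    rw [divAt_val, hf, germ_mul]
  · intro h x f hf
    have h1 := h x (f * s⁻¹) (by
      rw [germ_mul, germ_inv, ← hf, divAt_val]
      abel)
    simpa using h1

lemma inv_mul_mem_H0_divAt {D : CaDiv X} (h : (X.functionField)ˣ) {s : X.functionField}
    (hs : s ∈ H0 k D) : ((h⁻¹ : (X.functionField)ˣ) : X.functionField) * s ∈ H0 k (divAt D h) := by
  intro x f hf
  rw [← mul_assoc, ← Units.val_mul]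
  apply hs x
  rw [germ_mul, germ_inv, ← hf, divAt_val]
  abel

variable (k) in
/-- Multiplication by `h⁻¹` identifies the sections of `𝒪_X(D)` with those of
`𝒪_X(D + div h)`. -/
noncomputable def H0EquivDivAt (D : CaDiv X) (h : (X.functionField)ˣ) :
    H0 k D ≃ₗ[k] H0 k (divAt D h) where
  toFun s := ⟨_, inv_mul_mem_H0_divAt h s.2⟩
  invFun s := ⟨(h : X.functionField) * s, by
    have := inv_mul_mem_H0_divAt h⁻¹ s.2
    rwa [inv_inv, ← divAt_mul, mul_inv_cancel, divAt_one] at this⟩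
  map_add' s t := Subtype.ext (mul_add _ _ _)
  map_smul' c s := Subtype.ext (mul_smul_comm _ _ _)
  left_inv s := Subtype.ext (by simp)
  right_inv s := Subtype.ext (by simp)

theorem UnitsAreConstant.exists_smul_eq (hX : UnitsAreConstant X k) {D : CaDiv X}
    {f g : (X.functionField)ˣ} (h : divAt D f = divAt D g) :
    ∃ c : k, (f : X.functionField) = c • (g : X.functionField) := by
  obtain ⟨c, hc⟩ := hX.exists_algebraMap_eq (f := f * g⁻¹) (by
    have h1 : principal X (Additive.ofMul f) = principal X (Additive.ofMul g) :=
      add_right_cancel h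
    rw [ofMul_mul, map_add, ofMul_inv, map_neg, h1, add_neg_cancel])
  refine ⟨c, ?_⟩
  rw [Algebra.smul_def, hc, Units.val_mul, mul_assoc, Units.inv_mul, mul_one]

/-- If a linear map to a field sends each vector to a scalar multiple of its image under an
injective linear map, then all these scalars agree. -/
lemma _root_.LinearMap.exists_eq_smul_of_forall_exists_eq_smul {k V K : Type*} [Field k]
    [AddCommGroup V] [Module k V] [AddCommGroup K] [Module k K] (α β : V →ₗ[k] K)
    (hβ : Function.Injective β) (h : ∀ v, ∃ c : k, α v = c • β v) : ∃ c : k, α = c • β := by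
  choose c hc using h
  by_cases hV : ∃ w : V, w ≠ 0
  swap
  · push Not at hV
    exact ⟨0, LinearMap.ext fun v => by simp [hV v]⟩
  obtain ⟨w, hw⟩ := hV
  refine ⟨c w, LinearMap.ext fun v => ?_⟩
  rw [LinearMap.smul_apply]
  by_cases hlin : ∃ a : k, v = a • w
  · obtain ⟨a, rfl⟩ := hlin
    rw [map_smul, map_smul, hc w, smul_comm]
  · -- comparing the coefficients of `v` and `w` in `α (v + w)` gives `c v = c (v + w) = c w`
    have h1 : (c (v + w) - c v) • v + (c (v + w) - c w) • w = 0 := by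
      apply hβ
      have h2 : α (v + w) = α v + α w := map_add α v w
      rw [hc, hc v, hc w, map_add] at h2
      rw [map_add, map_smul, map_smul, map_zero, sub_smul, sub_smul]
      rw [smul_add] at h2
      rw [sub_add_sub_comm, h2, sub_self]
    have hv : c (v + w) - c v = 0 := by
      by_contra hne
      refine hlin ⟨-(c (v + w) - c v)⁻¹ * (c (v + w) - c w), ?_⟩
      rw [mul_smul, eq_neg_of_add_eq_zero_right h1, smul_neg, neg_smul, neg_neg,
        inv_smul_smul₀ hne]
    have hw' : c (v + w) - c w = 0 := by
      rw [hv, zero_smul, zero_add] at h1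
      exact (smul_eq_zero.mp h1).resolve_right hw
    rw [hc v, ← sub_eq_zero.mp hv, sub_eq_zero.mp hw']

/-- Two families of rational functions that depend linearly on a parameter and whose divisors
differ by a fixed divisor are proportional. -/
theorem UnitsAreConstant.exists_eq_mul (hX : UnitsAreConstant X k) {V : Type*} [AddCommGroup V]
    [Module k V] (α β : V →ₗ[k] X.functionField) (D E : CaDiv X)
    (h : ∀ v ≠ 0, ∃ a b : (X.functionField)ˣ, (a : X.functionField) = α v ∧
      (b : X.functionField) = β v ∧ divAt D a = divAt E b) :
    ∃ q : X.functionField, ∀ v, α v = q * β v := by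
  by_cases hV : ∃ w : V, w ≠ 0
  swap
  · push Not at hV
    exact ⟨0, fun v => by simp [hV v]⟩
  obtain ⟨w, hw⟩ := hV
  obtain ⟨a, b, ha, hb, hab⟩ := h w hw
  let β' : V →ₗ[k] X.functionField :=
    (LinearMap.mulLeft k ((a * b⁻¹ : (X.functionField)ˣ) : X.functionField)).comp β
  have hβ' : ∀ v, β' v = ((a * b⁻¹ : (X.functionField)ˣ) : X.functionField) * β v := fun v => rfl
  obtain ⟨c, hc⟩ := LinearMap.exists_eq_smul_of_forall_exists_eq_smul α β' (by
    refine (injective_iff_map_eq_zero β').mpr fun v hv => ?_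
    by_contra hne
    obtain ⟨_, b', -, hb', -⟩ := h v hne
    rw [hβ', ← hb', ← Units.val_mul] at hv
    exact Units.ne_zero _ hv) (fun v => by
    by_cases hv : v = 0
    · exact ⟨0, by simp [hv]⟩
    obtain ⟨a', b', ha', hb', hab'⟩ := h v hv
    rw [hβ', ← ha', ← hb', ← Units.val_mul]
    refine hX.exists_smul_eq (D := D) ?_
    rw [hab', mul_assoc, divAt_mul, hab, ← divAt_mul, mul_inv_cancel_left])
  refine ⟨c • ((a * b⁻¹ : (X.functionField)ˣ) : X.functionField), fun v => ?_⟩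
  rw [hc, LinearMap.smul_apply, hβ', smul_mul_assoc]

end Geometry

/-! ### Divisors of homogeneous elements of a Cox ring -/

namespace CoxStructure

section Basic

variable {k : Type u} [Field k] {X : Scheme.{u}} [X.Over (Spec (.of k))] [IsIntegral X]
  {M : Type v} [AddCommGroup M] [DecidableEq M] {lam : M →+ Pic X}
  {R : Type w} [CommRing R] [Algebra k R] {A : M → Submodule k R} (S : CoxStructure lam A)

include S

/-- The divisors of the homogeneous elements of degree `m` are described by one linear map to
`k(X)`, defined on all of `R`. -/
theorem exists_trivialization (m : M) : ∃ (D : CaDiv X) (ρ : R →ₗ[k] X.functionField),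
    cls D = lam m ∧ ∀ (s : R) (hs : s ∈ A m) (h0 : s ≠ 0),
      ∃ f : (X.functionField)ˣ, (f : X.functionField) = ρ s ∧ S.div ⟨s, h0, m, hs⟩ = divAt D f := by
  obtain ⟨D, hD⟩ := cls_surjective (lam m)
  obtain ⟨ψ, hψ⟩ := S.exists_equiv m D hD
  obtain ⟨ρ, hρ⟩ := LinearMap.exists_extend ((H0 k D).subtype.comp ψ.toLinearMap)
  refine ⟨D, ρ, hD, fun s hs h0 => ?_⟩
  obtain ⟨f, hf, hdiv⟩ := hψ s hs h0
  exact ⟨f, hf.trans (LinearMap.congr_fun hρ ⟨s, hs⟩).symm, hdiv⟩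

theorem isEffective_div (s : HomogNonzero A) : IsEffective (S.div s) := by
  obtain ⟨s, h0, m, hs⟩ := s
  obtain ⟨D, hD⟩ := cls_surjective (lam m)
  obtain ⟨ψ, hψ⟩ := S.exists_equiv m D hD
  obtain ⟨f, hf, hdiv⟩ := hψ s hs h0
  rw [hdiv, isEffective_divAt_iff (k := k), hf]
  exact (ψ ⟨s, hs⟩).2

theorem cls_div {s : R} {m : M} (hs : s ∈ A m) (h0 : s ≠ 0) :
    cls (S.div ⟨s, h0, m, hs⟩) = lam m := by
  obtain ⟨D, ρ, hD, hρ⟩ := S.exists_trivialization m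
  obtain ⟨f, -, hf⟩ := hρ s hs h0
  rw [hf, cls_divAt, hD]

/-- The degrees that occur in a Cox ring are those whose class is effective. -/
theorem exists_ne_zero_iff (m : M) : (∃ s ∈ A m, s ≠ 0) ↔ IsEffectiveClass (lam m) := by
  constructor
  · rintro ⟨s, hs, h0⟩
    exact ⟨_, S.isEffective_div ⟨s, h0, m, hs⟩, S.cls_div hs h0⟩
  · rintro ⟨D, hD, hcls⟩
    obtain ⟨ψ, -⟩ := S.exists_equiv m D hcls
    have h1 : (1 : X.functionField) ∈ H0 k D := by
      rw [← Units.val_one, ← isEffective_divAt_iff, divAt_one]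
      exact hD
    refine ⟨ψ.symm ⟨1, h1⟩, (ψ.symm ⟨1, h1⟩).2, fun h => ?_⟩
    have h2 : ψ.symm ⟨1, h1⟩ = 0 := Subtype.ext h
    rw [LinearEquiv.map_eq_zero_iff] at h2
    exact one_ne_zero (congrArg Subtype.val h2)

theorem mul_ne_zero_and_div_mul (s t : HomogNonzero A) : ∃ h : s.1 * t.1 ≠ 0 ∧ ∃ m, s.1 * t.1 ∈ A m,
    S.div ⟨s.1 * t.1, h⟩ = S.div s + S.div t := by
  obtain ⟨⟨r, hr⟩, h1, h2⟩ := S.div_mul s t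
  obtain rfl : r = s.1 * t.1 := h1
  exact ⟨hr, h2⟩

theorem div_one : ∃ h : (1 : R) ≠ 0 ∧ ∃ m, (1 : R) ∈ A m, S.div ⟨1, h⟩ = 0 := by
  have := S.gradedMonoid
  obtain ⟨s, -, hs⟩ := (S.exists_ne_zero_iff 0).mpr ⟨0, by
    intro x f hf
    have h1 : f ∈ stalkUnits X x := by
      have h : germ x f = germ x 1 := hf.symm
      simpa using QuotientGroup.eq.mp (Additive.ofMul.injective h).symm
    obtain ⟨u, rfl⟩ := h1
    exact ⟨u, rfl⟩, by rw [map_zero, map_zero]⟩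
  have h1 : (1 : R) ≠ 0 := fun h => hs (by rw [← mul_one s, h, mul_zero])
  have hA : (1 : R) ∈ A 0 := SetLike.one_mem_graded A
  refine ⟨⟨h1, 0, hA⟩, ?_⟩
  obtain ⟨r, hr, hdiv⟩ := S.div_mul ⟨1, h1, 0, hA⟩ ⟨1, h1, 0, hA⟩
  obtain rfl : r = ⟨1, h1, 0, hA⟩ := Subtype.ext (hr.trans (mul_one 1))
  exact left_eq_add.mp hdiv

end Basic

end CoxStructure

/-! ### Generators of a Cox ring and the associated character -/

/-- Nonzero homogeneous elements `f i` of a Cox ring whose degrees generate `M_eff`. Their divisors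
`D i` are a field, so that they can be taken to be those of given generator data on the nose. -/
structure HomogeneousFamily {k : Type u} [Field k] {X : Scheme.{u}} [X.Over (Spec (.of k))]
    [IsIntegral X] {M : Type v} [AddCommGroup M] [DecidableEq M] {lam : M →+ Pic X}
    {R : Type w} [CommRing R] [Algebra k R] {A : M → Submodule k R} (S : CoxStructure lam A)
    (N : ℕ) where
  f : Fin N → R
  deg : Fin N → M
  D : Fin N → CaDiv X
  mem : ∀ i, f i ∈ A (deg i)
  ne_zero : ∀ i, f i ≠ 0
  div_eq : ∀ i, S.div ⟨f i, ne_zero i, deg i, mem i⟩ = D i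
  closure_deg : AddSubgroup.closure (Set.range deg) = Meff lam

namespace HomogeneousFamily

variable {k : Type u} [Field k] {X : Scheme.{u}} [X.Over (Spec (.of k))] [IsIntegral X]
  {M : Type v} [AddCommGroup M] [DecidableEq M] {lam : M →+ Pic X}
  {R : Type w} [CommRing R] [Algebra k R] {A : M → Submodule k R} {S : CoxStructure lam A}
  {N : ℕ} (F : HomogeneousFamily S N)

/-- The monomial `f^a`. -/
noncomputable def mono (a : Fin N →₀ ℕ) : R :=
  MvPolynomial.aeval F.f (MvPolynomial.monomial a (1 : k))

lemma mono_add (a b : Fin N →₀ ℕ) : F.mono (a + b) = F.mono a * F.mono b := by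
  unfold mono
  rw [← map_mul, MvPolynomial.monomial_mul, one_mul]

lemma mono_zero : F.mono 0 = 1 := by simp [mono]

lemma mono_single (i : Fin N) (n : ℕ) : F.mono (Finsupp.single i n) = F.f i ^ n := by
  simp [mono, MvPolynomial.aeval_monomial]

lemma mono_mem (a : Fin N →₀ ℕ) : F.mono a ∈ A (Finsupp.weight F.deg a) := by
  have := S.gradedMonoid
  induction a using Finsupp.induction_linear with
  | zero =>
    rw [map_zero, mono_zero]
    exact SetLike.one_mem_graded A
  | add a b ha hb =>
    rw [map_add, mono_add]
    exact SetLike.mul_mem_graded ha hb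
  | single i n =>
    rw [mono_single, Finsupp.weight_single]
    exact SetLike.pow_mem_graded n (F.mem i)

lemma pow_div (i : Fin N) (n : ℕ) : ∃ h : F.f i ^ n ≠ 0 ∧ ∃ m, F.f i ^ n ∈ A m,
    S.div ⟨F.f i ^ n, h⟩ = n • F.D i := by
  induction n with
  | zero => simpa using S.div_one
  | succ n ih =>
    obtain ⟨h, h'⟩ := ih
    rw [succ_nsmul, ← h', ← F.div_eq i]
    simp only [pow_succ]
    exact S.mul_ne_zero_and_div_mul ⟨_, h⟩ ⟨F.f i, _⟩

lemma mono_div (a : Fin N →₀ ℕ) : ∃ h : F.mono a ≠ 0 ∧ ∃ m, F.mono a ∈ A m,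
    S.div ⟨F.mono a, h⟩ = comb F.D (expo a) := by
  induction a using Finsupp.induction_linear with
  | zero =>
    simp only [mono_zero, comb_expo, map_zero]
    exact S.div_one
  | add a b ha hb =>
    obtain ⟨ha, ha'⟩ := ha
    obtain ⟨hb, hb'⟩ := hb
    rw [expo_add, map_add, ← ha', ← hb']
    simp only [mono_add]
    exact S.mul_ne_zero_and_div_mul ⟨_, ha⟩ ⟨_, hb⟩
  | single i n =>
    simp only [mono_single, comb_expo, Finsupp.weight_single]
    exact F.pow_div i n

lemma mono_ne_zero (a : Fin N →₀ ℕ) : F.mono a ≠ 0 := (F.mono_div a).1.1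

/-- A divisor in the class `lam m` with respect to which elements of degree `m` are turned into
rational functions by `triv`. -/
noncomputable def base (_ : HomogeneousFamily S N) (m : M) : CaDiv X :=
  (S.exists_trivialization m).choose

/-- A linear map turning elements `s` of degree `m` into rational functions such that
`div s = div_{base m}(triv m s)`. Its values outside degree `m` are arbitrary. -/
noncomputable def triv (_ : HomogeneousFamily S N) (m : M) : R →ₗ[k] X.functionField :=
  (S.exists_trivialization m).choose_spec.choose

lemma exists_triv {m : M} {s : R} (hs : s ∈ A m) (h0 : s ≠ 0) :
    ∃ u : (X.functionField)ˣ, (u : X.functionField) = F.triv m s ∧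
      S.div ⟨s, h0, m, hs⟩ = divAt (F.base m) u :=
  (S.exists_trivialization m).choose_spec.choose_spec.2 s hs h0

/-- The rational function attached to the monomial `f^a`. -/
noncomputable def value (a : Fin N →₀ ℕ) : (X.functionField)ˣ :=
  (F.exists_triv (F.mono_mem a) (F.mono_ne_zero a)).choose

lemma value_coe {a : Fin N →₀ ℕ} {m : M} (h : Finsupp.weight F.deg a = m) :
    (F.value a : X.functionField) = F.triv m (F.mono a) := by
  subst h
  exact (F.exists_triv (F.mono_mem a) (F.mono_ne_zero a)).choose_spec.1

lemma divAt_value {a : Fin N →₀ ℕ} {m : M} (h : Finsupp.weight F.deg a = m) :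
    divAt (F.base m) (F.value a) = comb F.D (expo a) := by
  subst h
  rw [← (F.mono_div a).2]
  exact (F.exists_triv (F.mono_mem a) (F.mono_ne_zero a)).choose_spec.2.symm

variable (hX : UnitsAreConstant X k)
include hX

/-- Multiplication by a homogeneous element changes all trivialised values in a given degree by the
same factor. -/
theorem exists_triv_mul_eq {m n : M} {t : R} (ht : t ∈ A n) (h0 : t ≠ 0) :
    ∃ q : X.functionField, ∀ s ∈ A m, F.triv (m + n) (s * t) = q * F.triv m s := by
  have := S.gradedMonoid
  obtain ⟨q, hq⟩ := hX.exists_eq_mul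
    (((F.triv (m + n)).comp (LinearMap.mulRight k t)).comp (A m).subtype)
    ((F.triv m).comp (A m).subtype) (F.base (m + n)) (F.base m + S.div ⟨t, h0, n, ht⟩) (by
      rintro ⟨s, hs⟩ hs0
      have hs0 : s ≠ 0 := fun h => hs0 (Subtype.ext h)
      obtain ⟨h, hdiv⟩ := S.mul_ne_zero_and_div_mul ⟨s, hs0, m, hs⟩ ⟨t, h0, n, ht⟩
      obtain ⟨a, ha, ha'⟩ := F.exists_triv (SetLike.mul_mem_graded hs ht) h.1
      obtain ⟨b, hb, hb'⟩ := F.exists_triv hs hs0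
      refine ⟨a, b, ha, hb, ?_⟩
      rw [← ha', hdiv, hb', divAt, divAt, add_assoc])
  exact ⟨q, fun s hs => hq ⟨s, hs⟩⟩

/-- The quotient of the values of two monomials of equal degree does not change when both are
multiplied by the same monomial. -/
theorem value_add_mul_value {a b : Fin N →₀ ℕ}
    (hab : Finsupp.weight F.deg a = Finsupp.weight F.deg b) (c : Fin N →₀ ℕ) :
    F.value (a + c) * F.value b = F.value (b + c) * F.value a := by
  obtain ⟨q, hq⟩ := F.exists_triv_mul_eq hX (m := Finsupp.weight F.deg a) (F.mono_mem c)
    (F.mono_ne_zero c)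
  ext
  push_cast
  rw [F.value_coe (map_add _ a c), F.value_coe (a := b + c) (by rw [map_add, ← hab]),
    F.value_coe (a := a) rfl, F.value_coe (a := b) hab.symm, mono_add, mono_add,
    hq _ (F.mono_mem a), hq _ (hab ▸ F.mono_mem b)]
  ring

/-- The quotient of the values of two monomials of equal degree depends only on the difference of
the exponents. -/
theorem value_div_value_eq {a b a' b' : Fin N →₀ ℕ}
    (hab : Finsupp.weight F.deg a = Finsupp.weight F.deg b) (h : a + b' = a' + b) :
    F.value a / F.value b = F.value a' / F.value b' := by
  have hab' : Finsupp.weight F.deg a' = Finsupp.weight F.deg b' := by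
    have := congrArg (Finsupp.weight F.deg) h
    rw [map_add, map_add, hab, add_comm] at this
    exact (add_right_cancel this).symm
  have h1 := F.value_add_mul_value hX hab b'
  have h2 := F.value_add_mul_value hX hab' b
  rw [h, add_comm b b'] at h1
  have h3 : F.value a / F.value b = F.value (a' + b) / F.value (b' + b) := by
    rw [div_eq_div_iff_mul_eq_mul, mul_comm (F.value a), ← h1]
  rw [h3, div_eq_div_iff_mul_eq_mul, h2, mul_comm]

omit hX

/-- The positive part of a lattice vector, as an exponent vector. -/
noncomputable def posPart (E : Fin N → ℤ) : Fin N →₀ ℕ :=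
  Finsupp.equivFunOnFinite.symm fun i => (E i).toNat

lemma expo_posPart_sub (E : Fin N → ℤ) : expo (posPart E) - expo (posPart (-E)) = E := by
  ext i
  simp [expo, posPart]

lemma weight_eq_of_sub_mem {a b : Fin N →₀ ℕ} (h : expo a - expo b ∈ (comb F.deg).ker) :
    Finsupp.weight F.deg a = Finsupp.weight F.deg b := by
  rw [← comb_expo, ← comb_expo, ← sub_eq_zero, ← map_sub]
  exact h

lemma weight_posPart (E : (comb F.deg).ker) :
    Finsupp.weight F.deg (posPart E.1) = Finsupp.weight F.deg (posPart (-E.1)) := by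
  apply F.weight_eq_of_sub_mem
  rw [expo_posPart_sub]
  exact E.2

lemma expo_injective : Function.Injective (expo : (Fin N →₀ ℕ) → Fin N → ℤ) := fun a b h => by
  ext i
  exact Int.ofNat_injective (congrFun h i)

include hX

lemma value_div_value_eq_of_expo {a b a' b' : Fin N →₀ ℕ}
    (hab : Finsupp.weight F.deg a = Finsupp.weight F.deg b)
    (h : expo a - expo b = expo a' - expo b') :
    F.value a / F.value b = F.value a' / F.value b' := by
  apply F.value_div_value_eq hX hab
  apply expo_injective
  rw [expo_add, expo_add]
  exact sub_eq_sub_iff_add_eq_add.mp h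

/-- The character of `Λ_0` sending `a - b` to the quotient of the rational functions attached to the
monomials `f^a` and `f^b`. -/
noncomputable def character : (comb F.deg).ker →+ Additive (X.functionField)ˣ :=
  AddMonoidHom.mk' (fun E => Additive.ofMul (F.value (posPart E.1) / F.value (posPart (-E.1)))) (by
    intro E E'
    rw [← ofMul_mul]
    congr 1
    have h1 : F.value (posPart (E + E').1) / F.value (posPart (-(E + E').1)) =
        F.value (posPart E.1 + posPart E'.1) / F.value (posPart (-E.1) + posPart (-E'.1)) := by
      apply F.value_div_value_eq_of_expo hX (F.weight_posPart _)
      rw [expo_posPart_sub, expo_add, expo_add, add_sub_add_comm, expo_posPart_sub,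
        expo_posPart_sub]
      rfl
    have h2 : F.value (posPart E.1 + posPart E'.1) / F.value (posPart (-E.1) + posPart E'.1) =
        F.value (posPart E.1) / F.value (posPart (-E.1)) := by
      apply F.value_div_value_eq_of_expo hX
      · rw [map_add, map_add, F.weight_posPart E]
      · rw [expo_add, expo_add, add_sub_add_right_eq_sub]
    have h3 : F.value (posPart (-E.1) + posPart E'.1) /
        F.value (posPart (-E.1) + posPart (-E'.1)) =
        F.value (posPart E'.1) / F.value (posPart (-E'.1)) := by
      apply F.value_div_value_eq_of_expo hX
      · rw [map_add, map_add, F.weight_posPart E']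
      · rw [expo_add, expo_add, add_sub_add_left_eq_sub]
    rw [h1, ← h2, ← h3, div_mul_div_cancel])

lemma character_apply {a b : Fin N →₀ ℕ} (h : expo a - expo b ∈ (comb F.deg).ker) :
    (F.character hX ⟨_, h⟩).toMul = F.value a / F.value b := by
  apply F.value_div_value_eq_of_expo hX (F.weight_posPart _)
  rw [expo_posPart_sub]

/-- The generator data given by homogeneous elements of a Cox ring. -/
noncomputable def generatorData : GeneratorData lam N where
  deg := F.deg
  closure_deg := F.closure_deg
  D := F.D
  cls_D i := by rw [← F.div_eq, S.cls_div (F.mem i) (F.ne_zero i)]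
  effective_D i := by
    rw [← F.div_eq]
    exact S.isEffective_div _
  χ := F.character hX
  div_χ E := by
    have h := expo_posPart_sub E.1
    have hE : E = ⟨expo (posPart E.1) - expo (posPart (-E.1)), h.symm ▸ E.2⟩ := Subtype.ext h.symm
    conv_lhs => rw [hE, F.character_apply hX]
    conv_rhs => rw [← h, map_sub, ← F.divAt_value rfl, ← F.divAt_value (F.weight_posPart E).symm]
    rw [div_eq_mul_inv]
    unfold divAt
    rw [ofMul_mul, map_add, ofMul_inv, map_neg]
    abel

/-- For the generator data given by homogeneous elements of a Cox ring, the maps `φ_L` are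
proportional to the trivialisations in degree `φ(L)`; in particular they compute the divisors. -/
theorem phiL_generatorData (L : Fin N → ℤ) {p : MvPolynomial (Fin N) k}
    (hp : MvPolynomial.IsWeightedHomogeneous F.deg p (comb F.deg L)) :
    (MvPolynomial.aeval F.f p = 0 → (F.generatorData hX).phiL k L p = 0) ∧
    ∀ (hA : MvPolynomial.aeval F.f p ∈ A (comb F.deg L)) (h0 : MvPolynomial.aeval F.f p ≠ 0),
      ∃ u : (X.functionField)ˣ,
        (u : X.functionField) = (F.generatorData hX).phiL k L p ∧
        S.div ⟨_, h0, _, hA⟩ = divAt ((F.generatorData hX).DL L) u := by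
  by_cases hp0 : p = 0
  · subst hp0
    exact ⟨fun _ => map_zero _, fun _ h0 => absurd (map_zero _) h0⟩
  obtain ⟨b, hb⟩ := MvPolynomial.ne_zero_iff.mp hp0
  have hmem : ∀ {a}, p.coeff a ≠ 0 → expo a - L ∈ (comb F.deg).ker := fun {a} ha => by
    change comb F.deg _ = 0
    rw [map_sub, comb_expo, hp ha, sub_self]
  let χ := F.character hX
  let h : (X.functionField)ˣ := (χ ⟨_, hmem hb⟩).toMul / F.value b
  have key : ((F.generatorData hX).phiL k L p : X.functionField) =
      h * F.triv (comb F.deg L) (MvPolynomial.aeval F.f p) := by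
    rw [GeneratorData.phiL_apply_coe]
    conv_rhs => rw [p.as_sum, map_sum, map_sum, Finset.mul_sum]
    refine Finset.sum_congr rfl fun a ha => ?_
    have ha' : p.coeff a ≠ 0 := MvPolynomial.mem_support_iff.mp ha
    have hval : (F.generatorData hX).monomialValue L a = ((χ ⟨_, hmem ha'⟩).toMul :) :=
      (F.generatorData hX).monomialValue_of_mem (L := L) (a := a) (hmem ha')
    rw [hval]
    have hmon : MvPolynomial.monomial a (p.coeff a) =
        p.coeff a • MvPolynomial.monomial a (1 : k) := by
      rw [MvPolynomial.smul_monomial, smul_eq_mul, mul_one]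
    rw [hmon, map_smul, map_smul, mul_smul_comm]
    congr 1
    change _ = _ * F.triv _ (F.mono a)
    rw [← F.value_coe (hp ha'), ← Units.val_mul]
    congr 1
    have hab : expo a - expo b ∈ (comb F.deg).ker := by
      have := sub_mem (hmem ha') (hmem hb)
      rwa [sub_sub_sub_cancel_right] at this
    have e : (⟨_, hmem ha'⟩ : (comb F.deg).ker) = ⟨_, hab⟩ + ⟨_, hmem hb⟩ :=
      Subtype.ext (by simp)
    rw [e, map_add, toMul_add, F.character_apply hX]
    simp only [h, div_eq_mul_inv]
    rw [mul_comm, mul_assoc, mul_comm (F.value a)]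
  refine ⟨fun h0 => Subtype.ext (by rw [key, h0, map_zero, mul_zero]; rfl), fun hA h0 => ?_⟩
  obtain ⟨u, hu, hdiv⟩ := F.exists_triv hA h0
  refine ⟨h * u, by rw [key, Units.val_mul, hu], ?_⟩
  have h1 : divAt 0 (χ ⟨_, hmem hb⟩).toMul = comb F.D (expo b - L) :=
    (F.generatorData hX).div_χ ⟨_, hmem hb⟩
  have h2 : divAt (F.base (comb F.deg L)) (F.value b) = comb F.D (expo b) :=
    F.divAt_value (hp hb)
  have h3 : divAt (comb F.D L) h = F.base (comb F.deg L) := by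
    rw [map_sub, ← h2] at h1
    unfold divAt at h1 ⊢
    rw [add_zero] at h1
    simp only [h, div_eq_mul_inv]
    rw [ofMul_mul, ofMul_inv, map_add, map_neg, h1]
    abel
  rw [hdiv, ← h3, ← divAt_mul]
  rfl

end HomogeneousFamily

namespace GeneratorData

variable {k : Type u} [Field k] {X : Scheme.{u}} [X.Over (Spec (.of k))] [IsIntegral X]
  {M : Type v} [AddCommGroup M] {lam : M →+ Pic X} {N : ℕ} (P : GeneratorData lam N)

/-! ### Properties of the maps `φ_L` -/

lemma monomialValue_shift {L L' : Fin N → ℤ} (h : L - L' ∈ P.phi.ker) (a : Fin N →₀ ℕ) :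
    P.monomialValue L' a = ((P.χ ⟨L - L', h⟩).toMul : X.functionField) * P.monomialValue L a := by
  by_cases ha : expo a - L ∈ P.phi.ker
  · have e : expo a - L' = (L - L') + (expo a - L) := by abel
    have ha' : expo a - L' ∈ P.phi.ker := e ▸ add_mem h ha
    rw [P.monomialValue_of_mem ha, P.monomialValue_of_mem ha', ← Units.val_mul, ← toMul_add,
      ← map_add]
    congr 4
  · have ha' : expo a - L' ∉ P.phi.ker := fun h' => ha (by
      have := sub_mem h' h
      rwa [sub_sub_sub_cancel_right] at this)
    rw [P.monomialValue_of_notMem ha, P.monomialValue_of_notMem ha', mul_zero]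

lemma phiL_shift {L L' : Fin N → ℤ} (h : L - L' ∈ P.phi.ker) (p : MvPolynomial (Fin N) k) :
    (P.phiL k L' p : X.functionField) =
      ((P.χ ⟨L - L', h⟩).toMul : X.functionField) * P.phiL k L p := by
  rw [P.phiL_apply_coe, P.phiL_apply_coe, Finset.mul_sum]
  exact Finset.sum_congr rfl fun a _ => by rw [P.monomialValue_shift h, mul_smul_comm]

lemma monomialValue_add (L : Fin N → ℤ) (a b : Fin N →₀ ℕ) :
    P.monomialValue L (b + a) = P.monomialValue (L - expo b) a := by
  have e : expo (b + a) - L = expo a - (L - expo b) := by rw [expo_add]; abel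
  by_cases h : expo a - (L - expo b) ∈ P.phi.ker
  · rw [P.monomialValue_of_mem h, P.monomialValue_of_mem (e ▸ h)]
    simp only [e]
  · rw [P.monomialValue_of_notMem h, P.monomialValue_of_notMem (e ▸ h)]

lemma phiL_monomial_mul_coe (L : Fin N → ℤ) (b : Fin N →₀ ℕ) (c : k)
    (q : MvPolynomial (Fin N) k) :
    (P.phiL k L (MvPolynomial.monomial b c * q) : X.functionField) =
      c • (P.phiL k (L - expo b) q : X.functionField) := by
  induction q using MvPolynomial.induction_on' with
  | monomial a d =>
    rw [MvPolynomial.monomial_mul, P.phiL_monomial_coe, P.phiL_monomial_coe, mul_smul,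
      P.monomialValue_add]
  | add p q hp hq =>
    rw [mul_add, map_add, map_add, Submodule.coe_add, Submodule.coe_add, hp, hq, smul_add]

omit [X.Over (Spec (.of k))] in
lemma expo_sub_mem_ker {p : MvPolynomial (Fin N) k} {L : Fin N → ℤ}
    (hp : MvPolynomial.IsWeightedHomogeneous P.deg p (P.phi L)) {a : Fin N →₀ ℕ}
    (ha : p.coeff a ≠ 0) : expo a - L ∈ P.phi.ker := by
  change P.phi _ = 0
  rw [map_sub, comb_expo, hp ha, sub_self]

/-- The maps `φ_L` turn products of homogeneous polynomials into products of rational functions. -/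
theorem phiL_mul {L L' : Fin N → ℤ} {p : MvPolynomial (Fin N) k}
    (hp : MvPolynomial.IsWeightedHomogeneous P.deg p (P.phi L)) (q : MvPolynomial (Fin N) k) :
    (P.phiL k (L + L') (p * q) : X.functionField) = P.phiL k L p * P.phiL k L' q := by
  rw [P.phiL_apply_coe L p]
  conv_lhs => rw [p.as_sum]
  rw [Finset.sum_mul, map_sum, AddSubmonoidClass.coe_finsetSum, Finset.sum_mul]
  refine Finset.sum_congr rfl fun a ha => ?_
  have ha := P.expo_sub_mem_ker hp (MvPolynomial.mem_support_iff.mp ha)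
  have e : L' - (L + L' - expo a) = expo a - L := by abel
  rw [P.phiL_monomial_mul_coe, P.phiL_shift (e ▸ ha) q, P.monomialValue_of_mem ha, smul_mul_assoc]
  simp only [e]

lemma phiL_eq_zero_of_ne {p : MvPolynomial (Fin N) k} {m : M} {L : Fin N → ℤ}
    (hp : MvPolynomial.IsWeightedHomogeneous P.deg p m) (h : m ≠ P.phi L) : P.phiL k L p = 0 := by
  apply Subtype.ext
  rw [P.phiL_apply_coe]
  refine Finset.sum_eq_zero fun a ha => ?_
  rw [P.monomialValue_of_notMem, smul_zero]
  intro hmem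
  apply h
  rw [← hp (MvPolynomial.mem_support_iff.mp ha), ← comb_expo, ← sub_eq_zero, ← map_sub]
  exact hmem

lemma phiL_weightedHomogeneousComponent (L : Fin N → ℤ) (p : MvPolynomial (Fin N) k) :
    P.phiL k L (MvPolynomial.weightedHomogeneousComponent P.deg (P.phi L) p) = P.phiL k L p := by
  classical
  induction p using MvPolynomial.induction_on' with
  | monomial a c =>
    rw [MvPolynomial.weightedHomogeneousComponent_of_mem
      (MvPolynomial.isWeightedHomogeneous_monomial P.deg a c rfl)]
    split_ifs with h
    · rfl
    · rw [map_zero, P.phiL_eq_zero_of_ne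
        (MvPolynomial.isWeightedHomogeneous_monomial P.deg a c rfl) fun h' => h h'.symm]
  | add p q hp hq => rw [map_add, map_add, hp, hq, map_add]

omit [X.Over (Spec (.of k))] in
lemma exists_phi_eq_of_ne_zero {p : MvPolynomial (Fin N) k} {m : M}
    (hp : MvPolynomial.IsWeightedHomogeneous P.deg p m) (h0 : p ≠ 0) : ∃ L, P.phi L = m := by
  obtain ⟨a, ha⟩ := MvPolynomial.ne_zero_iff.mp h0
  exact ⟨expo a, by rw [comb_expo, hp ha]⟩

lemma exists_phi_eq_of_mem_Meff {m : M} (hm : m ∈ Meff lam) : ∃ L, P.phi L = m := by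
  rw [← P.closure_deg] at hm
  have : AddSubgroup.closure (Set.range P.deg) ≤ P.phi.range := by
    rw [AddSubgroup.closure_le]
    rintro _ ⟨i, rfl⟩
    exact ⟨Pi.single i 1, by simp [comb, Pi.single_apply]⟩
  exact this hm

/-! ### The induced maps on the quotient -/

variable {s : ℕ} (g : Fin s → MvPolynomial (Fin N) k)

omit [X.Over (Spec (.of k))] in
lemma exists_of_mem_quotGrading {m : M} {r : Quot g} (hr : r ∈ P.quotGrading g m) :
    ∃ p, MvPolynomial.IsWeightedHomogeneous P.deg p m ∧ Ideal.Quotient.mk _ p = r := hr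

omit [X.Over (Spec (.of k))] in
lemma mk_mem_quotGrading {m : M} {p : MvPolynomial (Fin N) k}
    (hp : MvPolynomial.IsWeightedHomogeneous P.deg p m) :
    Ideal.Quotient.mk (Ideal.span (Set.range g)) p ∈ P.quotGrading g m := ⟨p, hp, rfl⟩

/-- The linear map on all of `R` induced by `φ_L`; it vanishes in the degrees other than `φ(L)`. -/
noncomputable def quotMap (hg : P.AreRelations g) (L : Fin N → ℤ) :
    Quot g →ₗ[k] H0 (X := X) k (P.DL L) :=
  Submodule.liftQ ((Ideal.span (Set.range g)).restrictScalars k) (P.phiL k L)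
    (P.span_le_ker g hg L)

variable (hg : P.AreRelations g)

lemma quotMap_mk (L : Fin N → ℤ) (p : MvPolynomial (Fin N) k) :
    P.quotMap g hg L (Ideal.Quotient.mk _ p) = P.phiL k L p := rfl

lemma quotMap_shift {L L' : Fin N → ℤ} (h : L - L' ∈ P.phi.ker) (r : Quot g) :
    (P.quotMap g hg L' r : X.functionField) =
      ((P.χ ⟨L - L', h⟩).toMul : X.functionField) * P.quotMap g hg L r := by
  obtain ⟨p, rfl⟩ := Ideal.Quotient.mk_surjective r
  exact P.phiL_shift h p

lemma quotMap_mul {L : Fin N → ℤ} (L' : Fin N → ℤ) {r : Quot g}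
    (hr : r ∈ P.quotGrading g (P.phi L)) (t : Quot g) :
    (P.quotMap g hg (L + L') (r * t) : X.functionField) =
      P.quotMap g hg L r * P.quotMap g hg L' t := by
  obtain ⟨p, hp, rfl⟩ := P.exists_of_mem_quotGrading g hr
  obtain ⟨q, rfl⟩ := Ideal.Quotient.mk_surjective t
  exact P.phiL_mul hp q

lemma quotMap_eq_zero_of_ne {L : Fin N → ℤ} {m : M} {r : Quot g} (hr : r ∈ P.quotGrading g m)
    (h : m ≠ P.phi L) : P.quotMap g hg L r = 0 := by
  obtain ⟨p, hp, rfl⟩ := P.exists_of_mem_quotGrading g hr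
  exact P.phiL_eq_zero_of_ne hp h

omit [X.Over (Spec (.of k))] in
lemma exists_phi_eq_of_mem_quotGrading {m : M} {r : Quot g} (hr : r ∈ P.quotGrading g m)
    (h0 : r ≠ 0) : ∃ L, P.phi L = m := by
  obtain ⟨p, hp, rfl⟩ := P.exists_of_mem_quotGrading g hr
  exact P.exists_phi_eq_of_ne_zero hp fun h => h0 (by rw [h, map_zero])

omit [X.Over (Spec (.of k))] in
lemma gradedMonoid_quotGrading : SetLike.GradedMonoid (P.quotGrading g) where
  one_mem := ⟨1, MvPolynomial.isWeightedHomogeneous_one k P.deg, rfl⟩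
  mul_mem := by
    rintro m n _ _ ⟨p, hp, rfl⟩ ⟨q, hq, rfl⟩
    exact ⟨p * q, MvPolynomial.IsWeightedHomogeneous.mul hp hq, rfl⟩

section Injective

variable {g hg} (hinj : ∀ L, Function.Injective (P.inducedMap g hg L))
include hinj

lemma eq_zero_of_quotMap_eq_zero {L : Fin N → ℤ} {r : Quot g}
    (hr : r ∈ P.quotGrading g (P.phi L)) (h : P.quotMap g hg L r = 0) : r = 0 :=
  congrArg Subtype.val (hinj L (a₁ := ⟨r, hr⟩) (a₂ := 0) (by rw [map_zero]; exact h))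

/-- The map `φ_L` vanishes in all degrees but `φ(L)`, where it is injective. Hence a vanishing sum
of homogeneous elements has vanishing terms. -/
lemma isInternal_quotGrading [DecidableEq M] : DirectSum.IsInternal (P.quotGrading g) := by
  classical
  constructor
  · refine (injective_iff_map_eq_zero _).mpr fun x hx => ?_
    rw [DirectSum.coeAddMonoidHom_eq_dfinsuppSum, DFinsupp.sum] at hx
    ext m : 1
    by_contra h0
    have h0 : (x m : Quot g) ≠ 0 := fun h => h0 (Subtype.ext h)
    obtain ⟨L, rfl⟩ := P.exists_phi_eq_of_mem_quotGrading g (x m).2 h0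
    refine h0 (P.eq_zero_of_quotMap_eq_zero hinj (x _).2 ?_)
    have h1 := congrArg (P.quotMap g hg L) hx
    rw [map_sum, map_zero, Finset.sum_eq_single (P.phi L)] at h1
    · exact h1
    · exact fun n _ hn => P.quotMap_eq_zero_of_ne g hg (x n).2 hn
    · intro h
      rw [DFinsupp.notMem_support_iff.mp h]
      exact map_zero _
  · rw [← AddMonoidHom.mrange_eq_top, eq_top_iff]
    rintro r -
    obtain ⟨p, rfl⟩ := Ideal.Quotient.mk_surjective r
    induction p using MvPolynomial.induction_on' with
    | monomial a c =>
      exact ⟨DirectSum.of (fun m => P.quotGrading g m) _ ⟨_, P.mk_mem_quotGrading g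
        (MvPolynomial.isWeightedHomogeneous_monomial P.deg a c rfl)⟩,
        DirectSum.coeAddMonoidHom_of _ _ _⟩
    | add p q hp hq =>
      rw [map_add]
      exact add_mem hp hq

/-- The divisor `div_{D_L}(φ_L(r))` of a nonzero element `r` of `R` that is homogeneous of degree
`φ(L)`. Some `L` is chosen here; `exists_inducedDiv_eq` shows that all choices agree. -/
noncomputable def inducedDiv (r : HomogNonzero (P.quotGrading g)) : CaDiv X :=
  divAt (P.DL (P.exists_phi_eq_of_mem_quotGrading g r.2.2.choose_spec r.2.1).choose)
    (Units.mk0 (P.quotMap g hg (P.exists_phi_eq_of_mem_quotGrading g r.2.2.choose_spec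
      r.2.1).choose r.1 : X.functionField) fun h => r.2.1
        (P.eq_zero_of_quotMap_eq_zero hinj (by
          rw [(P.exists_phi_eq_of_mem_quotGrading g r.2.2.choose_spec r.2.1).choose_spec]
          exact r.2.2.choose_spec) (Subtype.ext h)))

lemma exists_inducedDiv_eq {L : Fin N → ℤ} {r : Quot g} (hr : r ∈ P.quotGrading g (P.phi L))
    (h : r ≠ 0 ∧ ∃ m, r ∈ P.quotGrading g m) :
    ∃ u : (X.functionField)ˣ, (u : X.functionField) = P.quotMap g hg L r ∧
      P.inducedDiv hinj ⟨r, h⟩ = divAt (P.DL L) u := by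
  have hL' := (P.exists_phi_eq_of_mem_quotGrading g h.2.choose_spec h.1).choose_spec
  set L' := (P.exists_phi_eq_of_mem_quotGrading g h.2.choose_spec h.1).choose with hdef
  have hphi : P.phi L' = P.phi L := by
    by_contra hne
    have hr' := h.2.choose_spec
    rw [← hL'] at hr'
    exact h.1 (P.eq_zero_of_quotMap_eq_zero hinj hr (P.quotMap_eq_zero_of_ne g hg hr' hne))
  have hker : L' - L ∈ P.phi.ker := by
    change P.phi _ = 0
    rw [map_sub, hphi, sub_self]
  have hne : (P.quotMap g hg L' r : X.functionField) ≠ 0 := fun h0 =>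
    h.1 (P.eq_zero_of_quotMap_eq_zero hinj (hphi ▸ hr) (Subtype.ext h0))
  refine ⟨(P.χ ⟨_, hker⟩).toMul * Units.mk0 _ hne, ?_, ?_⟩
  · rw [Units.val_mul, Units.val_mk0, ← P.quotMap_shift]
  · have h1 := P.div_χ ⟨_, hker⟩
    change divAt (P.DL L') (Units.mk0 _ hne) = _
    rw [divAt_mul]
    congr 1
    rw [map_sub] at h1
    unfold divAt at h1 ⊢
    rw [add_zero] at h1
    rw [ofMul_toMul] at h1 ⊢
    rw [h1, sub_add_cancel]

end Injective

/-- If the induced maps are bijective, they define a structure of Cox ring. -/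
theorem exists_isInduced_of_bijective [DecidableEq M]
    (hbij : ∀ L, Function.Bijective (P.inducedMap g hg L)) :
    ∃ S : CoxStructure lam (P.quotGrading g), P.IsInduced g hg S := by
  have hinj := fun L => (hbij L).1
  have hgm := P.gradedMonoid_quotGrading g
  refine ⟨⟨hgm, P.isInternal_quotGrading hinj, P.inducedDiv hinj, ?_, ?_⟩,
    fun L r hr h0 => P.exists_inducedDiv_eq hinj hr ⟨h0, _, hr⟩⟩
  · intro m D hD
    by_cases hm : ∃ L, P.phi L = m
    · obtain ⟨L, rfl⟩ := hm
      have hcls : cls (P.DL L) = cls D := by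
        rw [hD]
        simp [DL, phi, comb, P.cls_D, map_sum]
      obtain ⟨h, rfl⟩ := exists_divAt_eq_of_cls_eq hcls
      refine ⟨(LinearEquiv.ofBijective _ (hbij L)).trans (H0EquivDivAt k (P.DL L) h),
        fun r hr h0 => ?_⟩
      obtain ⟨u, hu, hdiv⟩ := P.exists_inducedDiv_eq hinj hr ⟨h0, _, hr⟩
      refine ⟨h⁻¹ * u, ?_, ?_⟩
      · rw [Units.val_mul, hu]
        rfl
      · rw [hdiv, ← divAt_mul, mul_inv_cancel_left]
    · -- a nonzero section of `𝒪_X(D)` would make the class of `D` effective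
      have h1 : Subsingleton (P.quotGrading g m) := ⟨fun r t => by
        have key : ∀ r : P.quotGrading g m, r = 0 := fun r => by
          by_contra h0
          exact hm (P.exists_phi_eq_of_mem_quotGrading g r.2 fun h => h0 (Subtype.ext h))
        rw [key r, key t]⟩
      have h2 : Subsingleton (H0 k D) := ⟨fun f h => by
        have key : ∀ f : H0 k D, f = 0 := fun f => by
          by_contra h0
          have h0 : (f : X.functionField) ≠ 0 := fun h => h0 (Subtype.ext h)
          refine hm (P.exists_phi_eq_of_mem_Meff (AddSubgroup.subset_closure
            ⟨_, (isEffective_divAt_iff (k := k) D (Units.mk0 _ h0)).mpr f.2, ?_⟩))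
          rw [cls_divAt, hD]
        rw [key f, key h]⟩
      refine ⟨⟨0, 0, fun _ => Subsingleton.elim _ _, fun _ => Subsingleton.elim _ _⟩,
        fun r hr h0 => absurd (congrArg Subtype.val (Subsingleton.elim (⟨r, hr⟩ :
          P.quotGrading g m) 0)) h0⟩
  · rintro ⟨r, hr0, m, hr⟩ ⟨t, ht0, n, ht⟩
    obtain ⟨L, rfl⟩ := P.exists_phi_eq_of_mem_quotGrading g hr hr0
    obtain ⟨L', rfl⟩ := P.exists_phi_eq_of_mem_quotGrading g ht ht0
    obtain ⟨u, hu, hdivu⟩ := P.exists_inducedDiv_eq hinj hr ⟨hr0, _, hr⟩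
    obtain ⟨v, hv, hdivv⟩ := P.exists_inducedDiv_eq hinj ht ⟨ht0, _, ht⟩
    have hmul := P.quotMap_mul g hg L' hr t
    rw [← hu, ← hv, ← Units.val_mul] at hmul
    have h0 : r * t ≠ 0 := fun h => by
      rw [h, map_zero] at hmul
      exact Units.ne_zero _ hmul.symm
    have hmem : r * t ∈ P.quotGrading g (P.phi (L + L')) := by
      rw [map_add]
      exact SetLike.mul_mem_graded hr ht
    obtain ⟨w, hw, hdivw⟩ := P.exists_inducedDiv_eq hinj hmem ⟨h0, _, hmem⟩
    refine ⟨⟨r * t, h0, _, hmem⟩, rfl, ?_⟩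
    obtain rfl : w = u * v := Units.ext (hw.trans hmul)
    rw [hdivw, hdivu, hdivv, divAt_add_divAt]
    congr 1
    exact map_add _ _ _

variable {P g hg} in
/-- If the induced maps compute the divisors of a structure of Cox ring, they are bijective. They
differ from the isomorphisms of that structure by a constant on each vector, so that every section
is the image of a multiple of its preimage. -/
theorem IsInduced.bijective [DecidableEq M]
    (hX : UnitsAreConstant X k) {S : CoxStructure lam (P.quotGrading g)}
    (hS : P.IsInduced g hg S) (L : Fin N → ℤ) : Function.Bijective (P.inducedMap g hg L) := by
  constructor
  · refine (injective_iff_map_eq_zero _).mpr ?_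
    rintro ⟨r, hr⟩ hr0
    by_contra h0
    obtain ⟨f, hf, -⟩ := hS L r hr fun h => h0 (Subtype.ext h)
    rw [hr0] at hf
    exact Units.ne_zero f hf
  · intro y
    by_cases hy : y = 0
    · exact ⟨0, by rw [hy, map_zero]⟩
    obtain ⟨ψ, hψ⟩ := S.exists_equiv (P.phi L) (P.DL L)
      (by simp [DL, phi, comb, P.cls_D, map_sum])
    have h0 : (ψ.symm y : Quot g) ≠ 0 := fun h => hy (by
      have : ψ.symm y = 0 := Subtype.ext h
      rwa [LinearEquiv.map_eq_zero_iff] at this)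
    obtain ⟨f, hf, hdiv⟩ := hψ _ (ψ.symm y).2 h0
    obtain ⟨f', hf', hdiv'⟩ := hS L _ (ψ.symm y).2 h0
    obtain ⟨c, hc⟩ := hX.exists_smul_eq (hdiv.symm.trans hdiv')
    refine ⟨c • ψ.symm y, Subtype.ext ?_⟩
    rw [map_smul, Submodule.coe_smul, ← hf', ← hc, hf]
    exact congrArg Subtype.val (ψ.apply_symm_apply y)

variable {P g hg} in
/-- For `L` the `i`-th unit vector, `φ_L(T_i) = χ(0) = 1`. -/
theorem IsInduced.variablesHaveDivisors [DecidableEq M]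
    {S : CoxStructure lam (P.quotGrading g)} (hS : P.IsInduced g hg S) :
    P.VariablesHaveDivisors g S := by
  intro i
  have hdeg : P.phi (Pi.single i 1) = P.deg i := by simp [comb, Pi.single_apply]
  have hD : P.DL (Pi.single i 1) = P.D i := by simp [DL, comb, Pi.single_apply]
  have hexpo : expo (Finsupp.single i 1) - Pi.single i 1 = 0 := by
    ext j
    by_cases h : j = i
    · subst h; simp [expo]
    · simp [expo, h]
  have hval : (P.phiL k (Pi.single i 1) (MvPolynomial.X i) : X.functionField) = 1 := by
    rw [MvPolynomial.X, P.phiL_monomial_coe,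
      P.monomialValue_of_mem (by rw [hexpo]; exact zero_mem _),
      one_smul]
    rw [show (⟨_, _⟩ : P.phi.ker) = 0 from Subtype.ext hexpo]
    change ((P.χ 0).toMul : X.functionField) = 1
    rw [map_zero]
    rfl
  have h0 : Ideal.Quotient.mk (Ideal.span (Set.range g)) (MvPolynomial.X i) ≠ 0 := fun h => by
    have h1 := P.quotMap_mk g hg (Pi.single i 1) (MvPolynomial.X i)
    rw [h, map_zero] at h1
    rw [← h1] at hval
    exact zero_ne_one hval
  have hmem : Ideal.Quotient.mk (Ideal.span (Set.range g)) (MvPolynomial.X i) ∈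
      P.quotGrading g (P.phi (Pi.single i 1)) := by
    rw [hdeg]
    exact P.mk_mem_quotGrading g (MvPolynomial.isWeightedHomogeneous_X k P.deg i)
  obtain ⟨u, hu, hdiv⟩ := hS _ _ hmem h0
  refine ⟨⟨_, h0, _, hmem⟩, rfl, ?_⟩
  obtain rfl : u = 1 := Units.ext (hu.trans hval)
  rw [hdiv, divAt_one, hD]

end GeneratorData

namespace GeneratorData

/-! ### Changing the character by constants -/

section Twist

variable {k : Type u} [Field k] {X : Scheme.{u}} [X.Over (Spec (.of k))] [IsIntegral X]
  {M : Type v} [AddCommGroup M] {lam : M →+ Pic X} {N : ℕ} (P : GeneratorData lam N)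

variable (k) in
/-- The ideal of the polynomials that are killed by all the maps `φ_L`. -/
noncomputable def kernelIdeal : Ideal (MvPolynomial (Fin N) k) where
  carrier := {p | ∀ L, P.phiL k L p = 0}
  zero_mem' L := map_zero _
  add_mem' hp hq L := by rw [map_add, hp L, hq L, add_zero]
  smul_mem' c p hp L := by
    rw [smul_eq_mul]
    induction c using MvPolynomial.induction_on' with
    | monomial b c =>
      apply Subtype.ext
      rw [P.phiL_monomial_mul_coe, hp]
      exact smul_zero c
    | add q r hq hr => rw [add_mul, map_add, hq, hr, add_zero]

lemma mem_kernelIdeal_of_isWeightedHomogeneous {p : MvPolynomial (Fin N) k} {L : Fin N → ℤ}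
    (hp : MvPolynomial.IsWeightedHomogeneous P.deg p (P.phi L)) (h : P.phiL k L p = 0) :
    p ∈ P.kernelIdeal k := fun L' => by
  by_cases hL : P.phi L = P.phi L'
  · have hker : L - L' ∈ P.phi.ker := by
      change P.phi _ = 0
      rw [map_sub, hL, sub_self]
    apply Subtype.ext
    rw [P.phiL_shift hker, h]
    exact mul_zero _
  · exact P.phiL_eq_zero_of_ne hp hL

section Relations

variable {s : ℕ} {g : Fin s → MvPolynomial (Fin N) k} (hg : P.AreRelations g)
include hg

lemma span_le_kernelIdeal : Ideal.span (Set.range g) ≤ P.kernelIdeal k :=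
  fun _ hp L => P.span_le_ker g hg L hp

lemma kernelIdeal_le_span_iff :
    P.kernelIdeal k ≤ Ideal.span (Set.range g) ↔
      ∀ L, Function.Injective (P.inducedMap g hg L) := by
  classical
  constructor
  · intro h L
    refine (injective_iff_map_eq_zero _).mpr ?_
    rintro ⟨r, hr⟩ h0
    obtain ⟨p, hp, rfl⟩ := P.exists_of_mem_quotGrading g hr
    exact Subtype.ext (Ideal.Quotient.eq_zero_iff_mem.mpr
      (h (P.mem_kernelIdeal_of_isWeightedHomogeneous hp h0)))
  · intro h p hp
    rw [← MvPolynomial.sum_weightedHomogeneousComponent P.deg p]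
    refine finsum_induction (· ∈ Ideal.span (Set.range g)) (zero_mem _)
      (fun _ _ => add_mem) fun m => ?_
    have hm := MvPolynomial.weightedHomogeneousComponent_isWeightedHomogeneous (w := P.deg) m p
    by_cases h0 : MvPolynomial.weightedHomogeneousComponent P.deg m p = 0
    · rw [h0]
      exact zero_mem _
    obtain ⟨L, rfl⟩ := P.exists_phi_eq_of_ne_zero hm h0
    refine Ideal.Quotient.eq_zero_iff_mem.mp
      (P.eq_zero_of_quotMap_eq_zero h (P.mk_mem_quotGrading g hm) ?_)
    rw [P.quotMap_mk g hg, P.phiL_weightedHomogeneousComponent, hp L]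

end Relations

variable (θ : (comb P.deg).ker →+ Additive (X.functionField)ˣ)
  (hθ : (principal X).comp θ = 0)

omit [X.Over (Spec (.of k))] in
lemma principal_zsmul_eq_zero {P : GeneratorData lam N}
    {θ : (comb P.deg).ker →+ Additive (X.functionField)ˣ} (hθ : (principal X).comp θ = 0)
    (n : ℤ) : (principal X).comp (n • θ) = 0 := by
  ext E : 1
  have h : principal X (θ E) = 0 := DFunLike.congr_fun hθ E
  change principal X (n • θ E) = 0
  rw [map_zsmul, h, zsmul_zero]

/-- The generator data obtained by changing the character by a homomorphism `θ` whose values have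
trivial divisor. -/
noncomputable def twist : GeneratorData lam N :=
  { P with
    χ := P.χ + θ
    div_χ := fun E => by
      have h : principal X (θ E) = 0 := DFunLike.congr_fun hθ E
      rw [← P.div_χ E]
      unfold divAt
      rw [AddMonoidHom.add_apply, ofMul_toMul, ofMul_toMul, map_add, h, add_zero] }

lemma twist_congr {θ θ' : (comb P.deg).ker →+ Additive (X.functionField)ˣ} (h : θ = θ')
    (hθ : (principal X).comp θ = 0) (hθ' : (principal X).comp θ' = 0) :
    P.twist θ hθ = P.twist θ' hθ' := by
  subst h
  rfl

lemma twist_eq_self (hθ : (principal X).comp θ = 0) (h : P.χ + θ = P.χ) : P.twist θ hθ = P := by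
  cases P
  unfold twist
  congr 1

lemma twist_twist {η ζ : (comb P.deg).ker →+ Additive (X.functionField)ˣ}
    (hη : (principal X).comp η = 0) (hζ : (principal X).comp ζ = 0) (h : ζ = η + θ) :
    (P.twist η hη).twist θ hθ = P.twist ζ hζ := by
  subst h
  unfold twist
  congr 1
  ext E : 1
  exact add_assoc (P.χ E) (η E) (θ E)

/-- Multiplication of the coefficient of `T^a` by `c (a - L)` for all `a` of degree `φ(L)`, and by
`0` for all other `a`. -/
noncomputable def twistCoeff (c : (comb P.deg).ker → k) (L : Fin N → ℤ) :
    MvPolynomial (Fin N) k →ₗ[k] MvPolynomial (Fin N) k := by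
  classical
  exact (MvPolynomial.basisMonomials (Fin N) k).constr k fun a =>
    if h : expo a - L ∈ P.phi.ker then MvPolynomial.monomial a (c ⟨_, h⟩) else 0

omit [X.Over (Spec (.of k))] in
lemma twistCoeff_monomial_of_mem (c : (comb P.deg).ker → k) {L : Fin N → ℤ} {a : Fin N →₀ ℕ}
    (h : expo a - L ∈ P.phi.ker) (d : k) :
    P.twistCoeff c L (MvPolynomial.monomial a d) = MvPolynomial.monomial a (d * c ⟨_, h⟩) := by
  have e : MvPolynomial.monomial a d = d • MvPolynomial.basisMonomials (Fin N) k a := by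
    simp [MvPolynomial.coe_basisMonomials, MvPolynomial.smul_monomial]
  rw [e, map_smul, twistCoeff, Module.Basis.constr_basis, dif_pos h, MvPolynomial.smul_monomial,
    smul_eq_mul]

omit [X.Over (Spec (.of k))] in
lemma twistCoeff_monomial_of_notMem (c : (comb P.deg).ker → k) {L : Fin N → ℤ} {a : Fin N →₀ ℕ}
    (h : expo a - L ∉ P.phi.ker) (d : k) :
    P.twistCoeff c L (MvPolynomial.monomial a d) = 0 := by
  have e : MvPolynomial.monomial a d = d • MvPolynomial.basisMonomials (Fin N) k a := by
    simp [MvPolynomial.coe_basisMonomials, MvPolynomial.smul_monomial]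
  rw [e, map_smul, twistCoeff, Module.Basis.constr_basis, dif_neg h, smul_zero]

omit [X.Over (Spec (.of k))] in
lemma isWeightedHomogeneous_twistCoeff (c : (comb P.deg).ker → k) (L : Fin N → ℤ)
    (p : MvPolynomial (Fin N) k) :
    MvPolynomial.IsWeightedHomogeneous P.deg (P.twistCoeff c L p) (P.phi L) := by
  induction p using MvPolynomial.induction_on' with
  | monomial a d =>
    by_cases h : expo a - L ∈ P.phi.ker
    · rw [P.twistCoeff_monomial_of_mem c h]
      refine MvPolynomial.isWeightedHomogeneous_monomial _ _ _ ?_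
      rw [← comb_expo, ← sub_eq_zero, ← map_sub]
      exact h
    · rw [P.twistCoeff_monomial_of_notMem c h]
      exact MvPolynomial.isWeightedHomogeneous_zero _ _ _
  | add p q hp hq =>
    rw [map_add]
    exact hp.add hq

/-- Changing the character by constants amounts to changing the coefficients of homogeneous
polynomials by these constants. -/
theorem phiL_twistCoeff {c : (comb P.deg).ker → k}
    (hc : ∀ E, algebraMap k X.functionField (c E) = (θ E).toMul) (L : Fin N → ℤ)
    (p : MvPolynomial (Fin N) k) :
    (P.phiL k L (P.twistCoeff c L p) : X.functionField) = (P.twist θ hθ).phiL k L p := by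
  induction p using MvPolynomial.induction_on' with
  | monomial a d =>
    rw [phiL_monomial_coe]
    by_cases h : expo a - L ∈ P.phi.ker
    · have hval : (P.twist θ hθ).monomialValue L a =
          (((P.χ ⟨_, h⟩).toMul * (θ ⟨_, h⟩).toMul : (X.functionField)ˣ) : X.functionField) :=
        (P.twist θ hθ).monomialValue_of_mem (L := L) (a := a) h
      rw [P.twistCoeff_monomial_of_mem c h, phiL_monomial_coe, P.monomialValue_of_mem h, hval,
        mul_smul, Algebra.smul_def (c _), hc, mul_comm, ← Units.val_mul, mul_comm]
    · have hval : (P.twist θ hθ).monomialValue L a = 0 :=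
        (P.twist θ hθ).monomialValue_of_notMem (L := L) (a := a) h
      rw [P.twistCoeff_monomial_of_notMem c h, map_zero, hval, smul_zero]
      rfl
  | add p q hp hq =>
    rw [map_add, map_add, map_add, Submodule.coe_add, Submodule.coe_add, hp, hq]

lemma mem_kernelIdeal_twist_iff {c : (comb P.deg).ker → k}
    (hc : ∀ E, algebraMap k X.functionField (c E) = (θ E).toMul) {p : MvPolynomial (Fin N) k} :
    p ∈ (P.twist θ hθ).kernelIdeal k ↔ ∀ L, P.twistCoeff c L p ∈ P.kernelIdeal k := by
  refine forall_congr' fun L => ?_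
  have h := P.phiL_twistCoeff θ hθ hc L p
  constructor
  · intro h0
    refine P.mem_kernelIdeal_of_isWeightedHomogeneous (P.isWeightedHomogeneous_twistCoeff c L p)
      (Subtype.ext ?_)
    rw [h, h0]
    rfl
  · intro h0
    refine Subtype.ext ?_
    rw [← h, h0 L]
    rfl

/-- Changing the characters of two sets of data by the same constants preserves inclusions of
kernel ideals. -/
lemma kernelIdeal_twist_mono (hX : UnitsAreConstant X k)
    {η η' : (comb P.deg).ker →+ Additive (X.functionField)ˣ}
    {hη : (principal X).comp η = 0} {hη' : (principal X).comp η' = 0}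
    (h : (P.twist η hη).kernelIdeal k ≤ (P.twist η' hη').kernelIdeal k)
    {ζ ζ' : (comb P.deg).ker →+ Additive (X.functionField)ˣ}
    {hζ : (principal X).comp ζ = 0} {hζ' : (principal X).comp ζ' = 0}
    (e : ζ = η + θ) (e' : ζ' = η' + θ) :
    (P.twist ζ hζ).kernelIdeal k ≤ (P.twist ζ' hζ').kernelIdeal k := by
  have hθ : (principal X).comp θ = 0 := by
    rw [e, AddMonoidHom.comp_add, hη, zero_add] at hζ
    exact hζ
  choose c hc using fun E => hX.exists_algebraMap_eq (f := (θ E).toMul) (DFunLike.congr_fun hθ E)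
  have h1 := P.twist_twist θ hθ hη hζ e
  have h2 := P.twist_twist θ hθ hη' hζ' e'
  intro p hp
  rw [← h1, (P.twist η hη).mem_kernelIdeal_twist_iff θ hθ hc] at hp
  rw [← h2, (P.twist η' hη').mem_kernelIdeal_twist_iff θ hθ hc]
  exact fun L => h (hp L)

/-- If the kernel ideal grows when the character is changed by constants, it does not change at
all: repeating the change gives an ascending chain of ideals of a Noetherian ring, in which all
steps are of the same kind. -/
theorem kernelIdeal_twist_le_of_le (hX : UnitsAreConstant X k)
    (h : P.kernelIdeal k ≤ (P.twist θ hθ).kernelIdeal k) :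
    (P.twist θ hθ).kernelIdeal k ≤ P.kernelIdeal k := by
  have h0 : P.twist ((0 : ℤ) • θ) (principal_zsmul_eq_zero hθ 0) = P := by
    refine P.twist_eq_self _ _ ?_
    ext E : 1
    exact (congrArg (P.χ E + ·) (zero_zsmul (θ E))).trans (add_zero _)
  have h1 : P.twist ((1 : ℤ) • θ) (principal_zsmul_eq_zero hθ 1) = P.twist θ hθ :=
    P.twist_congr (one_zsmul θ) _ _
  rw [← h1] at h ⊢
  have hstep : ∀ n : ℕ, (P.twist ((n : ℤ) • θ) (principal_zsmul_eq_zero hθ _)).kernelIdeal k ≤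
      (P.twist (((n + 1 : ℕ) : ℤ) • θ) (principal_zsmul_eq_zero hθ _)).kernelIdeal k := fun n =>
    P.kernelIdeal_twist_mono ((n : ℤ) • θ) hX (η := (0 : ℤ) • θ)
      (η' := (1 : ℤ) • θ)
      (hη := principal_zsmul_eq_zero hθ 0) (hη' := principal_zsmul_eq_zero hθ 1)
      (by rw [h0]; exact h)
      ((congrArg (· • θ) (zero_add (n : ℤ)).symm).trans (add_zsmul θ _ _))
      ((congrArg (· • θ) (by push_cast; ring)).trans (add_zsmul θ _ _))
  obtain ⟨n, hn⟩ := monotone_stabilizes_iff_noetherian.mpr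
    (inferInstance : IsNoetherian (MvPolynomial (Fin N) k) (MvPolynomial (Fin N) k))
    ⟨_, monotone_nat_of_le_succ hstep⟩
  have hle := P.kernelIdeal_twist_mono (-(n : ℤ) • θ) hX (hn (n + 1) n.le_succ).ge
    (ζ := (1 : ℤ) • θ) (ζ' := (0 : ℤ) • θ) (hζ := principal_zsmul_eq_zero hθ 1)
    (hζ' := principal_zsmul_eq_zero hθ 0)
    ((congrArg (· • θ) (by push_cast; ring)).trans (add_zsmul θ _ _))
    ((congrArg (· • θ) (by ring)).trans (add_zsmul θ _ _))
  rwa [h0] at hle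

/-- Bijectivity of the induced maps does not change when the character is changed by constants, as
long as the `g_i` are relations for both characters. -/
theorem bijective_inducedMap_twist (hX : UnitsAreConstant X k) {s : ℕ}
    {g : Fin s → MvPolynomial (Fin N) k} (hg : P.AreRelations g)
    (hbij : ∀ L, Function.Bijective (P.inducedMap g hg L))
    (hg' : (P.twist θ hθ).AreRelations g) (L : Fin N → ℤ) :
    Function.Bijective ((P.twist θ hθ).inducedMap g hg' L) := by
  have hle := (P.kernelIdeal_le_span_iff hg).mpr fun L => (hbij L).1
  have hle' := P.kernelIdeal_twist_le_of_le θ hθ hX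
    (hle.trans ((P.twist θ hθ).span_le_kernelIdeal hg'))
  refine ⟨((P.twist θ hθ).kernelIdeal_le_span_iff hg').mp (hle'.trans hle) L, fun y => ?_⟩
  obtain ⟨⟨r, hr⟩, hry⟩ := (hbij L).2 y
  obtain ⟨p, hp, rfl⟩ := P.exists_of_mem_quotGrading g hr
  have hθ' : (principal X).comp (-θ) = 0 := by
    rw [AddMonoidHom.comp_neg, hθ, neg_zero]
  choose c hc using fun E =>
    hX.exists_algebraMap_eq (f := ((-θ) E).toMul) (DFunLike.congr_fun hθ' E)
  have htwist : (P.twist θ hθ).twist (-θ) hθ' = P := by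
    have h0 : (principal X).comp (0 : (comb P.deg).ker →+ _) = 0 := AddMonoidHom.comp_zero _
    rw [P.twist_twist (-θ) hθ' hθ h0 (add_neg_cancel θ).symm]
    refine P.twist_eq_self 0 h0 ?_
    ext E : 1
    exact add_zero (P.χ E)
  have key := (P.twist θ hθ).phiL_twistCoeff (-θ) hθ' hc L p
  refine ⟨⟨_, (P.twist θ hθ).mk_mem_quotGrading g
    ((P.twist θ hθ).isWeightedHomogeneous_twistCoeff c L p)⟩, Subtype.ext ?_⟩
  refine key.trans ?_
  rw [htwist]
  exact congrArg Subtype.val hry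

lemma bijective_inducedMap_of_twist_eq {Q : GeneratorData lam N} (hQ : P.twist θ hθ = Q)
    (hX : UnitsAreConstant X k) {s : ℕ} {g : Fin s → MvPolynomial (Fin N) k}
    (hg : P.AreRelations g) (hbij : ∀ L, Function.Bijective (P.inducedMap g hg L))
    (hg' : Q.AreRelations g) (L : Fin N → ℤ) : Function.Bijective (Q.inducedMap g hg' L) := by
  subst hQ
  exact P.bijective_inducedMap_twist θ hθ hX hg hbij hg' L

end Twist

/-! ### Cox ring structures for which the variables have the given divisors -/

section Variables

variable {k : Type u} [Field k] {X : Scheme.{u}} [X.Over (Spec (.of k))] [IsIntegral X]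
  {M : Type v} [AddCommGroup M] [DecidableEq M] {lam : M →+ Pic X} {N : ℕ}
  {P : GeneratorData lam N} {s : ℕ} {g : Fin s → MvPolynomial (Fin N) k}

lemma aeval_mk_X (p : MvPolynomial (Fin N) k) :
    MvPolynomial.aeval (fun i => Ideal.Quotient.mk (Ideal.span (Set.range g))
        (MvPolynomial.X i)) p =
      Ideal.Quotient.mk (Ideal.span (Set.range g)) p :=
  DFunLike.congr_fun (MvPolynomial.algHom_ext
    (g := Ideal.Quotient.mkₐ k (Ideal.span (Set.range g))) fun i => by
      rw [MvPolynomial.aeval_X]; rfl) p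

/-- The family of the variables of `R`. -/
noncomputable def variableFamily {S : CoxStructure lam (P.quotGrading g)}
    (hS : P.VariablesHaveDivisors g S) : HomogeneousFamily S N where
  f := fun i => Ideal.Quotient.mk _ (MvPolynomial.X i)
  deg := P.deg
  D := P.D
  mem := fun i => P.mk_mem_quotGrading g (MvPolynomial.isWeightedHomogeneous_X k P.deg i)
  ne_zero := fun i => by
    obtain ⟨t, ht, -⟩ := hS i
    rw [← ht]
    exact t.2.1
  div_eq := fun i => by
    obtain ⟨⟨t, ht0⟩, ht, hdiv⟩ := hS i
    obtain rfl : t = _ := ht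
    exact hdiv
  closure_deg := P.closure_deg

variable (hX : UnitsAreConstant X k) {S : CoxStructure lam (P.quotGrading g)}
  (hS : P.VariablesHaveDivisors g S)

lemma areRelations_variableFamily (hg : P.AreRelations g) :
    ((variableFamily hS).generatorData hX).AreRelations g := fun i =>
  ⟨(hg i).1, fun L hL => ((variableFamily hS).phiL_generatorData hX L hL).1 <| by
    change MvPolynomial.aeval (fun i => Ideal.Quotient.mk _ (MvPolynomial.X i)) _ = _
    rw [aeval_mk_X, Ideal.Quotient.eq_zero_iff_mem]
    exact Ideal.subset_span ⟨i, rfl⟩⟩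

/-- A structure in which the variables have divisors `D_i` is induced by its own character. -/
lemma isInduced_variableFamily (hg' : ((variableFamily hS).generatorData hX).AreRelations g) :
    ((variableFamily hS).generatorData hX).IsInduced g hg' S := fun L r hr h0 => by
  obtain ⟨p, hp, rfl⟩ := P.exists_of_mem_quotGrading g hr
  have h := ((variableFamily hS).phiL_generatorData hX L hp).2
  have e : MvPolynomial.aeval (variableFamily hS).f p =
      Ideal.Quotient.mk (Ideal.span (Set.range g)) p := aeval_mk_X p
  simp only [e] at h
  exact h hr h0

/-- Two characters with the prescribed divisors differ by a homomorphism with trivial divisors. -/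
lemma exists_twist_eq :
    ∃ (θ : (comb ((variableFamily hS).generatorData hX).deg).ker →+ Additive (X.functionField)ˣ)
      (hθ : (principal X).comp θ = 0), ((variableFamily hS).generatorData hX).twist θ hθ = P := by
  let χ' : (comb P.deg).ker →+ Additive (X.functionField)ˣ := (variableFamily hS).character hX
  have hχ : χ' + (P.χ - χ') = P.χ := by
    ext E : 1
    exact add_sub_cancel (χ' E) (P.χ E)
  refine ⟨P.χ - χ', ?_, ?_⟩
  · ext E : 1
    have h1 : principal X (P.χ E) = comb P.D E.1 := (add_zero _).symm.trans (P.div_χ E)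
    have h2 : principal X (χ' E) = comb P.D E.1 :=
      (add_zero _).symm.trans (((variableFamily hS).generatorData hX).div_χ E)
    change principal X (P.χ E - χ' E) = 0
    rw [map_sub, h1, h2, sub_self]
  · change ({ P with χ := χ' + (P.χ - χ'), div_χ := _ } : GeneratorData lam N) = P
    simp only [hχ]

include hX hS in
/-- If the variables have divisors `D_i`, the induced maps are bijective: this holds for the
character that the structure itself defines, which differs from the given one by constants. -/
theorem VariablesHaveDivisors.bijective (hg : P.AreRelations g) (L : Fin N → ℤ) :
    Function.Bijective (P.inducedMap g hg L) := by
  have hg' := areRelations_variableFamily hX hS hg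
  have hbij := fun L => (isInduced_variableFamily hX hS hg').bijective hX L
  obtain ⟨θ, hθ, htwist⟩ := exists_twist_eq hX hS
  exact bijective_inducedMap_of_twist_eq _ θ hθ htwist hX hg' hbij hg L

end Variables

end GeneratorData

/-! ### Presentations of finitely generated Cox rings -/

section Graded

variable {k : Type u} [Field k] {M : Type v} [AddCommGroup M] [DecidableEq M]
  {R : Type w} [CommRing R] [Algebra k R] (A : M → Submodule k R) [GradedAlgebra A] {N : ℕ}
  {f : Fin N → R} {deg : Fin N → M} (hf : ∀ i, f i ∈ A (deg i))
include hf

lemma aeval_monomial_mem (a : Fin N →₀ ℕ) (c : k) :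
    MvPolynomial.aeval f (MvPolynomial.monomial a c) ∈ A (Finsupp.weight deg a) := by
  rw [MvPolynomial.aeval_monomial, ← Algebra.smul_def, Finsupp.weight_apply]
  exact Submodule.smul_mem _ _
    (SetLike.prod_mem_graded _ _ _ fun i _ => SetLike.pow_mem_graded _ (hf i))

/-- Evaluation at homogeneous elements commutes with taking homogeneous components. -/
theorem decompose_aeval (p : MvPolynomial (Fin N) k) (m : M) :
    (DirectSum.decompose A (MvPolynomial.aeval f p) m : R) =
      MvPolynomial.aeval f (MvPolynomial.weightedHomogeneousComponent deg m p) := by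
  induction p using MvPolynomial.induction_on' with
  | monomial a c =>
    have hmem := aeval_monomial_mem A hf a c
    rw [MvPolynomial.weightedHomogeneousComponent_of_mem
      (MvPolynomial.isWeightedHomogeneous_monomial deg a c rfl)]
    split_ifs with h
    · rw [h, DirectSum.decompose_of_mem_same A hmem]
    · rw [DirectSum.decompose_of_mem_ne A hmem fun h' => h h'.symm, map_zero]
  | add p q hp hq =>
    rw [map_add, DirectSum.decompose_add, DirectSum.add_apply, Submodule.coe_add, hp, hq, map_add,
      map_add]

lemma aeval_mem_of_isWeightedHomogeneous {p : MvPolynomial (Fin N) k} {m : M}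
    (hp : MvPolynomial.IsWeightedHomogeneous deg p m) : MvPolynomial.aeval f p ∈ A m := by
  have h := decompose_aeval A hf p m
  rw [hp.weightedHomogeneousComponent_same] at h
  rw [← h]
  exact SetLike.coe_mem _

/-- If homogeneous elements generate the algebra, every degree that occurs in it is a combination of
their degrees. -/
lemma mem_closure_range_of_ne_zero (hsurj : Function.Surjective (MvPolynomial.aeval (R := k) f))
    {m : M} {r : R} (hr : r ∈ A m) (h0 : r ≠ 0) : m ∈ AddSubgroup.closure (Set.range deg) := by
  obtain ⟨p, rfl⟩ := hsurj r
  have h := decompose_aeval A hf p m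
  rw [DirectSum.decompose_of_mem_same A hr] at h
  have hne : MvPolynomial.weightedHomogeneousComponent deg m p ≠ 0 := fun hz =>
    h0 (by rw [h, hz, map_zero])
  obtain ⟨a, ha⟩ := MvPolynomial.ne_zero_iff.mp hne
  rw [← MvPolynomial.weightedHomogeneousComponent_isWeightedHomogeneous m p ha,
    Finsupp.weight_apply]
  exact AddSubgroup.sum_mem _ fun i _ =>
    AddSubgroup.nsmul_mem _ (AddSubgroup.subset_closure (Set.mem_range_self i)) _

/-- The relations between homogeneous elements are generated by finitely many homogeneous ones. -/
theorem exists_homogeneous_relations : ∃ (s : ℕ) (g : Fin s → MvPolynomial (Fin N) k),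
    (∀ i, ∃ m, MvPolynomial.IsWeightedHomogeneous deg (g i) m) ∧
      Ideal.span (Set.range g) = RingHom.ker (MvPolynomial.aeval (R := k) f) := by
  let H : Set (MvPolynomial (Fin N) k) := {p | (∃ m, MvPolynomial.IsWeightedHomogeneous deg p m) ∧
    p ∈ RingHom.ker (MvPolynomial.aeval (R := k) f)}
  have hH : Ideal.span H = RingHom.ker (MvPolynomial.aeval (R := k) f) := by
    refine le_antisymm (Ideal.span_le.mpr fun p hp => hp.2) fun p hp => ?_
    rw [← MvPolynomial.sum_weightedHomogeneousComponent deg p]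
    refine finsum_induction (· ∈ Ideal.span H) (zero_mem _) (fun _ _ => add_mem) fun m =>
      Ideal.subset_span
        ⟨⟨m, MvPolynomial.weightedHomogeneousComponent_isWeightedHomogeneous m p⟩, ?_⟩
    rw [RingHom.mem_ker] at hp ⊢
    rw [← decompose_aeval A hf, hp, DirectSum.decompose_zero]
    rfl
  obtain ⟨T, hTH, hT⟩ := (Submodule.fg_span_iff_fg_span_finset_subset H).mp
    (IsNoetherian.noetherian (Ideal.span H))
  refine ⟨T.card, fun i => T.equivFin.symm i, fun i => (hTH (T.equivFin.symm i).2).1, ?_⟩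
  have hrange : Set.range (fun i => (T.equivFin.symm i : MvPolynomial (Fin N) k)) = T := by
    rw [← Function.comp_def, T.equivFin.symm.surjective.range_comp]
    exact Subtype.range_coe
  rw [hrange, ← hH]
  exact hT.symm

omit hf

/-- A finitely generated graded algebra is generated by finitely many nonzero homogeneous
elements. -/
theorem exists_homogeneous_generators [Algebra.FiniteType k R] :
    ∃ (N : ℕ) (f : Fin N → R) (deg : Fin N → M), (∀ i, f i ∈ A (deg i)) ∧ (∀ i, f i ≠ 0) ∧
      Function.Surjective (MvPolynomial.aeval (R := k) f) := by
  classical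
  obtain ⟨G, hG⟩ := Algebra.FiniteType.out (R := k) (A := R)
  let T : Finset R := G.biUnion fun x =>
    (DirectSum.decompose A x).support.image fun m => (DirectSum.decompose A x m : R)
  have hT : ∀ r ∈ T, ∃ m, r ∈ A m ∧ r ≠ 0 := fun r hr => by
    obtain ⟨x, -, hx⟩ := Finset.mem_biUnion.mp hr
    obtain ⟨m, hm, rfl⟩ := Finset.mem_image.mp hx
    exact ⟨m, SetLike.coe_mem _, fun h => (DFinsupp.mem_support_iff.mp hm) (Subtype.ext h)⟩
  choose! d hd using hT
  refine ⟨T.card, fun i => T.equivFin.symm i, fun i => d (T.equivFin.symm i),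
    fun i => (hd _ (T.equivFin.symm i).2).1, fun i => (hd _ (T.equivFin.symm i).2).2, ?_⟩
  have hrange : Set.range (fun i => (T.equivFin.symm i : R)) = T := by
    rw [← Function.comp_def, T.equivFin.symm.surjective.range_comp]
    exact Subtype.range_coe
  rw [← AlgHom.range_eq_top, ← Algebra.adjoin_range_eq_range_aeval, hrange, ← top_le_iff, ← hG,
    Algebra.adjoin_le_iff]
  intro x hx
  rw [← DirectSum.sum_support_decompose A x]
  exact sum_mem fun m hm => Algebra.subset_adjoin
    (Finset.mem_biUnion.mpr ⟨x, hx, Finset.mem_image_of_mem _ hm⟩)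

end Graded

section Transport

variable {k : Type u} [Field k] {X : Scheme.{u}} [X.Over (Spec (.of k))] [IsIntegral X]
  {M : Type v} [AddCommGroup M] [DecidableEq M] {lam : M →+ Pic X}
  {R : Type w} [CommRing R] [Algebra k R] {A : M → Submodule k R} (S : CoxStructure lam A)
  {Q : Type*} [CommRing Q] [Algebra k Q] {B : M → Submodule k Q} (e : Q ≃ₐ[k] R)
  (h : ∀ m r, r ∈ B m ↔ e r ∈ A m)

/-- Transport of a homogeneous element along an isomorphism of graded algebras. -/
def HomogNonzero.map (r : HomogNonzero B) : HomogNonzero A :=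
  ⟨e r.1, (map_ne_zero_iff e e.injective).mpr r.2.1, r.2.2.imp fun m => (h m r.1).mp⟩

/-- Transport of a structure of Cox ring along an isomorphism of graded algebras. -/
def CoxStructure.comap : CoxStructure lam B where
  gradedMonoid :=
    have := S.gradedMonoid
    { one_mem := by
        rw [h, map_one]
        exact SetLike.one_mem_graded A
      mul_mem := fun {m n r t} hr ht => by
        rw [h] at hr ht ⊢
        rw [map_mul]
        exact SetLike.mul_mem_graded hr ht }
  isInternal := by
    have hB : B = fun m => Submodule.orderIsoMapComap e.symm.toLinearEquiv (A m) := by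
      ext m r
      rw [h]
      constructor
      · exact fun hr => ⟨_, hr, e.symm_apply_apply r⟩
      · rintro ⟨t, ht, rfl⟩
        exact (congrArg (· ∈ A m) (e.apply_symm_apply t)).mpr ht
    have hA := (DirectSum.isInternal_submodule_iff_iSupIndep_and_iSup_eq_top A).mp S.isInternal
    rw [DirectSum.isInternal_submodule_iff_iSupIndep_and_iSup_eq_top, hB]
    refine ⟨hA.1.map_orderIso _, ?_⟩
    rw [← OrderIso.map_iSup, hA.2, OrderIso.map_top]
  div r := S.div (HomogNonzero.map e h r)
  exists_equiv m D hD := by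
    obtain ⟨ψ, hψ⟩ := S.exists_equiv m D hD
    have hB : (B m).map e.toLinearEquiv.toLinearMap = A m := by
      ext r
      constructor
      · rintro ⟨t, ht, rfl⟩
        exact (h m t).mp ht
      · exact fun hr => ⟨e.symm r, (h m _).mpr (by rwa [e.apply_symm_apply]),
          e.apply_symm_apply r⟩
    refine ⟨(e.toLinearEquiv.ofSubmodules (B m) (A m) hB).trans ψ, fun r hr h0 => ?_⟩
    exact hψ (e r) ((h m r).mp hr) ((map_ne_zero_iff e e.injective).mpr h0)
  div_mul r t := by
    obtain ⟨⟨y, hy0, m, hy⟩, hmul, hdiv⟩ :=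
      S.div_mul (HomogNonzero.map e h r) (HomogNonzero.map e h t)
    obtain rfl : y = e (r.1 * t.1) := hmul.trans (map_mul e _ _).symm
    exact ⟨⟨r.1 * t.1, fun h0 => hy0 (by rw [h0, map_zero]), m, (h m _).mpr hy⟩, rfl, hdiv⟩

lemma CoxStructure.isomorphic_comap : S.Isomorphic (S.comap e h) := by
  refine ⟨e.symm, fun m s => by rw [h, e.apply_symm_apply], ?_⟩
  rintro ⟨s, hs⟩ ⟨t, ht⟩ hst
  obtain rfl : s = e t := e.symm_apply_eq.mp hst
  rfl

end Transport

section Presentation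

variable {k : Type u} [Field k] {X : Scheme.{u}} [X.Over (Spec (.of k))] [IsIntegral X]
  {M : Type v} [AddCommGroup M] [DecidableEq M] {lam : M →+ Pic X}
  {R : Type w} [CommRing R] [Algebra k R]

/-- Every finitely generated Cox ring has a presentation whose structure of Cox ring is given by the
induced maps. -/
theorem CoxStructure.exists_presentation (hX : UnitsAreConstant X k) [Algebra.FiniteType k R]
    {A : M → Submodule k R} (S : CoxStructure lam A) :
    ∃ (N : ℕ) (P : GeneratorData lam N) (s : ℕ) (g : Fin s → MvPolynomial (Fin N) k)
      (hg : P.AreRelations g) (S' : CoxStructure lam (P.quotGrading g)),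
      P.IsInduced g hg S' ∧ S.Isomorphic S' := by
  have hgm := S.gradedMonoid
  let hdec := S.isInternal.chooseDecomposition
  let hgr : GradedAlgebra A := { hgm, hdec with }
  obtain ⟨N, f, deg, hf, h0, hsurj⟩ := exists_homogeneous_generators A
  obtain ⟨s, g, hghom, hspan⟩ := exists_homogeneous_relations A hf
  let F : HomogeneousFamily S N :=
    { f := f
      deg := deg
      D := fun i => S.div ⟨f i, h0 i, deg i, hf i⟩
      mem := hf
      ne_zero := h0
      div_eq := fun i => rfl
      closure_deg := by
        apply le_antisymm
        · rw [AddSubgroup.closure_le]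
          rintro _ ⟨i, rfl⟩
          exact AddSubgroup.subset_closure ((S.exists_ne_zero_iff _).mp ⟨f i, hf i, h0 i⟩)
        · rw [Meff, AddSubgroup.closure_le]
          intro m hm
          obtain ⟨r, hr, hr0⟩ := (S.exists_ne_zero_iff m).mpr hm
          exact mem_closure_range_of_ne_zero A hf hsurj hr hr0 }
  have hrel : ∀ i, MvPolynomial.aeval f (g i) = 0 := fun i => by
    have : g i ∈ RingHom.ker (MvPolynomial.aeval (R := k) f) := by
      rw [← hspan]
      exact Ideal.subset_span ⟨i, rfl⟩
    exact this
  have hg : (F.generatorData hX).AreRelations g := fun i =>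
    ⟨hghom i, fun L hL => (F.phiL_generatorData hX L hL).1 (hrel i)⟩
  let e : GeneratorData.Quot g ≃ₐ[k] R := (Ideal.quotientEquivAlgOfEq k hspan).trans
    (Ideal.quotientKerAlgEquivOfSurjective hsurj)
  have he : ∀ p, e (Ideal.Quotient.mk _ p) = MvPolynomial.aeval f p := fun p => rfl
  have hmem : ∀ m r, r ∈ (F.generatorData hX).quotGrading g m ↔ e r ∈ A m := fun m r => by
    constructor
    · rintro ⟨p, hp, rfl⟩
      exact aeval_mem_of_isWeightedHomogeneous A hf hp
    · intro hr
      obtain ⟨p, rfl⟩ := Ideal.Quotient.mk_surjective r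
      rw [he] at hr
      have h1 := decompose_aeval A hf p m
      rw [DirectSum.decompose_of_mem_same A hr, ← he, ← he] at h1
      rw [e.injective h1]
      exact (F.generatorData hX).mk_mem_quotGrading g
        (MvPolynomial.weightedHomogeneousComponent_isWeightedHomogeneous m p)
  refine ⟨N, F.generatorData hX, s, g, hg, S.comap e hmem, fun L r hr h0 => ?_,
    S.isomorphic_comap e hmem⟩
  obtain ⟨p, hp, rfl⟩ := (F.generatorData hX).exists_of_mem_quotGrading g hr
  exact (F.phiL_generatorData hX L hp).2 ((hmem _ _).mp hr)
    ((map_ne_zero_iff e e.injective).mpr h0)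

end Presentation

end CoxRing

theorem mainTheorem6 (k : Type u) [Field k] [IsSepClosed k]
    (X : Scheme.{u}) [X.Over (Spec (.of k))] [IsIntegral X]
    [GeometricallyIntegral (X ↘ Spec (.of k))] [IsSeparated (X ↘ Spec (.of k))]
    [LocallyOfFiniteType (X ↘ Spec (.of k))] [QuasiCompact (X ↘ Spec (.of k))]
    (hX : ∀ f : Γ(X, ⊤), IsUnit f → ∃ c : k, CoxRing.constants k X c = f)
    (M : Type v) [AddCommGroup M] [DecidableEq M] [AddGroup.FG M]
    (hM : ¬ ringChar k ∣ Nat.card (AddCommGroup.torsion M))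
    (lam : M →+ CoxRing.Pic X) :
    (∀ (N : ℕ) (P : CoxRing.GeneratorData lam N) (s : ℕ) (g : Fin s → MvPolynomial (Fin N) k)
        (hg : P.AreRelations g),
      ((∃ S : CoxRing.CoxStructure lam (P.quotGrading g), P.IsInduced g hg S) ↔
        ∀ L, Function.Bijective (P.inducedMap g hg L)) ∧
      ((∃ S : CoxRing.CoxStructure lam (P.quotGrading g), P.VariablesHaveDivisors g S) ↔
        ∀ L, Function.Bijective (P.inducedMap g hg L))) ∧
    (∀ (R : Type w) [CommRing R] [Algebra k R] [Algebra.FiniteType k R] (A : M → Submodule k R)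
        (S : CoxRing.CoxStructure lam A),
      ∃ (N : ℕ) (P : CoxRing.GeneratorData lam N) (s : ℕ) (g : Fin s → MvPolynomial (Fin N) k)
        (hg : P.AreRelations g) (S' : CoxRing.CoxStructure lam (P.quotGrading g)),
        P.IsInduced g hg S' ∧ S.Isomorphic S') := by

  refine ⟨fun N P s g hg => ?_, fun R _ _ _ A S => S.exists_presentation hX⟩
  have hc : (∀ L, Function.Bijective (P.inducedMap g hg L)) →
      ∃ S : CoxRing.CoxStructure lam (P.quotGrading g), P.IsInduced g hg S :=
    P.exists_isInduced_of_bijective g hg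
  refine ⟨⟨fun ⟨S, hS⟩ => hS.bijective hX, hc⟩, ⟨fun ⟨S, hS⟩ => hS.bijective hX hg, fun hbij => ?_⟩⟩
  obtain ⟨S, hS⟩ := hc hbij
  exact ⟨S, hS.variablesHaveDivisors⟩
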